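/- Let $\mathbb H$ be the quaternions, $\mathbb S=\{I\in\mathbb H: I^2=-1\}$, $\mathbb C_I=\mathbb R+\mathbb R I$ for $I\in\mathbb S$, and write $q=x_0+x_1i+x_2j+x_3k$. An axially symmetric slice domain is a domain $\Omega\subset\mathbb H$ that meets $\mathbb R$, such that $\Omega\cap\mathbb C_I$ is a domain of $\mathbb C_I$ for every $I\in\mathbb S$, and such that $x+Iy\in\Omega$ implies $x+Jy\in\Omega$ for all $J\in\mathbb S$. A slice function on $\Omega$ is a function of the form $f(x+Iy)=a(x,y)+I\,b(x,y)$ with $\mathbb H$-valued $a$ even and $b$ odd in $y$. The space $\mathcal{SP}_{n+1}(\Omega)$ of slice polyanalytic functions of order $n+1$ consists of the slice functions $f$ of class $C^{n+1}$ on $\Omega$ with $\frac1{2^{n+1}}(\partial_x+I\partial_y)^{n+1}f(x+Iy)=0$ on $\Omega\cap\mathbb C_I$ for every $I\in\mathbb S$; $\mathcal{SR}(\Omega)=\mathcal{SP}_1(\Omega)$. Each $g\in\mathcal{SP}_{n+1}(\Omega)$ is uniquely $g=\sum_{k=0}^n\bar q^{\,k}g_k$ with $g_k\in\mathcal{SR}(\Omega)$,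 and the polyanalytic Fueter map is $\mathcal C_{n+1}(g)=\sum_{k=0}^n x_0^k\,\Delta g_k$, with $\Delta$ the Laplacian on $\mathbb H\cong\mathbb R^4$. Put $$Q_s(q,\bar q)=\sum_{j=0}^s\frac{2(s-j+1)}{(s+1)(s+2)}\,q^{s-j}\bar q^{\,j},\qquad \mathcal M_{k,s}(q,\bar q)=x_0^k\,Q_s(q,\bar q).$$ Theorem. Let $n\ge 0$, let $\Omega$ be an axially symmetric slice domain with $0\in\Omega$, and let $B$ be the largest open ball centred at $0$ contained in $\Omega$ ($B=\mathbb H$ if $\Omega=\mathbb H$). All expansions below are over $0\le k\le n$, with the inner series absolutely convergent at every point of the indicated set. 1. A function $f$ on $B$ belongs to $\mathcal C_{n+1}(\mathcal{SP}_{n+1}(B))$ if and only if there are $\beta_{k,s}\in\mathbb H$ with $$f(q)=\sum_{k=0}^n\sum_{s=0}^\infty\mathcal M_{k,s}(q,\bar q)\,\beta_{k,s},\qquad q\in B.$$ 2. Every $f\in\mathcal C_{n+1}(\mathcal{SP}_{n+1}(\Omega))$ has such an expansion on $B$; conversely, every function $f$ on $\Omega$ that has such an expansion on all of $\Omega$ belongs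 to $\mathcal C_{n+1}(\mathcal{SP}_{n+1}(\Omega))$. 3. Every $g\in\mathcal{SP}_{n+1}(\Omega)$ has an expansion $g(q)=\sum_{k=0}^n\sum_{j=0}^\infty\bar q^{\,k}q^j\alpha_{k,j}$ on $B$ with $\alpha_{k,j}\in\mathbb H$, and for every such expansion $$\mathcal C_{n+1}(g)(q)=\sum_{k=0}^n\sum_{s=0}^\infty\mathcal M_{k,s}(q,\bar q)\,\beta_{k,s}\quad(q\in B),\qquad \beta_{k,s}=-2(s+1)(s+2)\,\alpha_{k,s+2}.$$ 4. Conversely, if $f(q)=\sum_{k=0}^n\sum_{s=0}^\infty\mathcal M_{k,s}(q,\bar q)\beta_{k,s}$ on $\Omega$ with $\beta_{k,s}=-2(s+1)(s+2)\alpha_{k,s+2}$ for some $\alpha_{k,j}\in\mathbb H$, then there is $g\in\mathcal{SP}_{n+1}(\Omega)$ with $g(q)=\sum_{k=0}^n\sum_{j=0}^\infty\bar q^{\,k}q^j\alpha_{k,j}$ and $f(q)=\mathcal C_{n+1}(g)(q)$ for all $q\in\Omega$. -/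

import Mathlib

open scoped Quaternion

noncomputable section

namespace SlicePoly

/-- The sphere of imaginary units. -/
def imagUnits : Set ℍ[ℝ] := {I | I ^ 2 = -1}

/-- The quaternion `x + I y`. -/
def slicePoint (I : ℍ[ℝ]) (x y : ℝ) : ℍ[ℝ] := (x : ℍ[ℝ]) + y • I

/-- The complex plane `ℝ + ℝ I`. -/
def slicePlane (I : ℍ[ℝ]) : Set ℍ[ℝ] := {q | ∃ x y : ℝ, q = slicePoint I x y}

/-- Axial symmetry: with `x + I y` the set contains the whole sphere `x + y 𝕊`. -/
def IsAxiallySymmetric (Ω : Set ℍ[ℝ]) : Prop :=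
  ∀ x y : ℝ, ∀ I ∈ imagUnits, ∀ J ∈ imagUnits, slicePoint I x y ∈ Ω → slicePoint J x y ∈ Ω

/-- A slice domain: a domain that meets the real line and whose intersection with every plane
`ℝ + ℝ I` is a domain of that plane (openness in the plane is automatic). -/
structure IsSliceDomain (Ω : Set ℍ[ℝ]) : Prop where
  isOpen : IsOpen Ω
  isConnected : IsConnected Ω
  meets_real : ∃ x : ℝ, (x : ℍ[ℝ]) ∈ Ω
  slice_connected : ∀ I ∈ imagUnits, IsConnected (Ω ∩ slicePlane I)

/-- Slice functions on `Ω`: `f (x + I y) = a (x, y) + I b (x, y)` with `a` even and `b` odd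
in `y`. -/
def IsSliceFunction (Ω : Set ℍ[ℝ]) (f : ℍ[ℝ] → ℍ[ℝ]) : Prop :=
  ∃ a b : ℝ → ℝ → ℍ[ℝ],
    (∀ x y, a x (-y) = a x y) ∧ (∀ x y, b x (-y) = -b x y) ∧
    ∀ I ∈ imagUnits, ∀ x y : ℝ, slicePoint I x y ∈ Ω →
      f (slicePoint I x y) = a x y + I * b x y

/-- The operator `(1/2) (∂/∂x + I ∂/∂y)`. At a point of the plane `ℝ + ℝ I` the two line
derivatives are the partial derivatives in `x` and `y` of the restriction of `f` to that plane. -/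
def dbar (I : ℍ[ℝ]) (f : ℍ[ℝ] → ℍ[ℝ]) (q : ℍ[ℝ]) : ℍ[ℝ] :=
  (1 / 2 : ℝ) • (lineDeriv ℝ f q 1 + I * lineDeriv ℝ f q I)

/-- (Left) slice hyperholomorphic functions on `Ω`. -/
structure IsSliceRegular (Ω : Set ℍ[ℝ]) (f : ℍ[ℝ] → ℍ[ℝ]) : Prop where
  contDiffOn : ContDiffOn ℝ 1 f Ω
  slice : IsSliceFunction Ω f
  dbar_eq_zero : ∀ I ∈ imagUnits, ∀ q ∈ Ω ∩ slicePlane I, dbar I f q = 0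

/-- (Left) slice polyanalytic functions of order `m` on `Ω`. -/
structure IsSlicePolyanalytic (m : ℕ) (Ω : Set ℍ[ℝ]) (f : ℍ[ℝ] → ℍ[ℝ]) : Prop where
  contDiffOn : ContDiffOn ℝ m f Ω
  slice : IsSliceFunction Ω f
  dbar_eq_zero : ∀ I ∈ imagUnits, ∀ q ∈ Ω ∩ slicePlane I, (dbar I)^[m] f q = 0

/-- `F 0, …, F n` are slice hyperholomorphic on `Ω` and `f = ∑ k, conj(q) ^ k * F k` there. -/
def IsPolyDecomposition (n : ℕ) (Ω : Set ℍ[ℝ]) (f : ℍ[ℝ] → ℍ[ℝ])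
    (F : Fin (n + 1) → ℍ[ℝ] → ℍ[ℝ]) : Prop :=
  (∀ k, IsSliceRegular Ω (F k)) ∧
    ∀ q ∈ Ω, f q = ∑ k : Fin (n + 1), star q ^ (k : ℕ) * F k q

open Classical in
/-- The components of the polyanalytic decomposition of `f` on `Ω` (for a slice polyanalytic `f`
of order `n + 1` on an axially symmetric slice domain they exist, and are unique on `Ω`). -/
def polyComponent (n : ℕ) (Ω : Set ℍ[ℝ]) (f : ℍ[ℝ] → ℍ[ℝ]) : Fin (n + 1) → ℍ[ℝ] → ℍ[ℝ] :=
  if h : ∃ F, IsPolyDecomposition n Ω f F then h.choose else 0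

/-- The polyanalytic Fueter map of order `n + 1`: `f = ∑ k, conj(q) ^ k * f k` is sent to
`∑ k, x₀ ^ k * Δ (f k)`, with `x₀ = Re q` and `Δ` the Laplacian in the four real variables. -/
def fueterMap (n : ℕ) (Ω : Set ℍ[ℝ]) (f : ℍ[ℝ] → ℍ[ℝ]) (q : ℍ[ℝ]) : ℍ[ℝ] :=
  ∑ k : Fin (n + 1), q.re ^ (k : ℕ) • Laplacian.laplacian (polyComponent n Ω f k) q

/-- `f`, as a function on `Ω`, lies in the image of the slice polyanalytic functions of order
`n + 1` on `Ω` under the polyanalytic Fueter map. -/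
def InFueterRange (n : ℕ) (Ω : Set ℍ[ℝ]) (f : ℍ[ℝ] → ℍ[ℝ]) : Prop :=
  ∃ g, IsSlicePolyanalytic (n + 1) Ω g ∧ Set.EqOn f (fueterMap n Ω g) Ω

/-- The quaternionic Appell polynomials. -/
def appellQ (s : ℕ) (q : ℍ[ℝ]) : ℍ[ℝ] :=
  ∑ j ∈ Finset.range (s + 1),
    (2 * ((s : ℝ) - j + 1) / (((s : ℝ) + 1) * ((s : ℝ) + 2))) • (q ^ (s - j) * star q ^ j)

/-- The generalized Appell polynomials `x₀ ^ k * Q_s`. -/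
def appellM (k s : ℕ) (q : ℍ[ℝ]) : ℍ[ℝ] := q.re ^ k • appellQ s q

/-- On `U`: `f = ∑_{k ≤ n} ∑_{j ≥ 0} conj(q) ^ k * q ^ j * α k j`, each series in `j` being
(absolutely) convergent. -/
def HasPolyExpansion (n : ℕ) (f : ℍ[ℝ] → ℍ[ℝ]) (α : Fin (n + 1) → ℕ → ℍ[ℝ])
    (U : Set ℍ[ℝ]) : Prop :=
  ∀ q ∈ U, (∀ k : Fin (n + 1), Summable fun j : ℕ => star q ^ (k : ℕ) * q ^ j * α k j) ∧
    f q = ∑ k : Fin (n + 1), ∑' j : ℕ, star q ^ (k : ℕ) * q ^ j * α k j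

/-- On `U`: `f = ∑_{k ≤ n} ∑_{s ≥ 0} M_{k,s} * β k s`, each series in `s` being (absolutely)
convergent. -/
def HasAppellExpansion (n : ℕ) (f : ℍ[ℝ] → ℍ[ℝ]) (β : Fin (n + 1) → ℕ → ℍ[ℝ])
    (U : Set ℍ[ℝ]) : Prop :=
  ∀ q ∈ U, (∀ k : Fin (n + 1), Summable fun s : ℕ => appellM k s q * β k s) ∧
    f q = ∑ k : Fin (n + 1), ∑' s : ℕ, appellM k s q * β k s

/-- The coefficients `β k s = -2 (s + 1) (s + 2) α k (s + 2)`. -/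
def fueterCoeff {n : ℕ} (α : Fin (n + 1) → ℕ → ℍ[ℝ]) (k : Fin (n + 1)) (s : ℕ) : ℍ[ℝ] :=
  (-2 * ((s : ℝ) + 1) * ((s : ℝ) + 2)) • α k (s + 2)

/-- The largest open ball centred at the origin contained in `Ω` (all of `ℍ` if `Ω` is). -/
def originBall (Ω : Set ℍ[ℝ]) : Set ℍ[ℝ] :=
  {q | ∃ r : ℝ, q ∈ Metric.ball 0 r ∧ Metric.ball 0 r ⊆ Ω}

end SlicePoly

end

/-!
A function on an axially symmetric open set `Ω` which is a slice function is determined by its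
restriction to the single slice `ℝ + ℝ i` (`IsSliceFunction.eqOn_sliceExt`), and there the
operator `dbar` is the usual Cauchy-Riemann operator for functions with values in `ℍ`, viewed as a
complex vector space by left multiplication. Conversely a holomorphic function on the slice extends
by the representation formula to a slice regular function (`isSliceRegular_sliceExt`). The extension
is smooth away from the real axis since the coordinates `Re q`, `‖Im q‖` are, and near a real point
because it is the sum of a convergent power series there.

On one slice a function killed by the `(n + 1)`-st power of the Cauchy-Riemann operator is a
polynomial in `conj z` with holomorphic coefficients: the top coefficient is `1 / n!` times the
`n`-th iterate, and one subtracts and inducts; the coefficients are unique for the same reason.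
Extending the coefficients gives the polyanalytic decomposition
(`IsSlicePolyanalytic.exists_polyDecomposition`, `IsPolyDecomposition.unique`), so the Fueter map may
be computed from any decomposition. On a ball centred at the origin the components are their Taylor
series, and since `∑ e x e = -2 conj x` over the basis `e = 1, i, j, k`, differentiating
`∑ q ^ j c j` twice termwise yields `Δ (q ^ (s + 2)) = -2 (s + 1) (s + 2) Q_s`
(`laplacian_qSeries`). This gives the expansions on the origin ball.

For the converse, the point is that convergence of an Appell expansion on all of `Ω`, which need not
be a ball, forces the underlying power series to converge on `Ω`
(`summable_of_summable_appellM`). Indeed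
`(q - conj q) ^ 2 ∑ (s - j + 1) q ^ (s - j) conj q ^ j
  = (s + 1) q ^ (s + 2) - (s + 2) q ^ (s + 1) conj q + conj q ^ (s + 2)`
bounds `Q_s` from below at nonreal points, and close to any point of `Ω` there is one of larger norm
which is neither real nor purely imaginary. The sums of these power series are slice regular, and
assemble to the required preimage (`HasAppellExpansion.exists_preimage`).
-/

namespace SlicePoly

open scoped ContDiff ComplexConjugate

/-! ### Power series in a quaternionic variable -/

/-- The first derivative of `q ↦ q ^ m` in the direction `e`. -/
noncomputable def powDeriv (e q : ℍ[ℝ]) : ℕ → ℍ[ℝ]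
  | 0 => 0
  | m + 1 => powDeriv e q m * q + q ^ m * e

/-- The second derivative of `q ↦ q ^ m` in the direction `e`. -/
noncomputable def powDeriv₂ (e q : ℍ[ℝ]) : ℕ → ℍ[ℝ]
  | 0 => 0
  | m + 1 => q * powDeriv₂ e q m + (2 : ℝ) • (e * powDeriv e q m)

/-- The recursion with the new factor on the left, matching the definition of `powDeriv₂`; the
recursion with the factor on the right is the one compatible with multiplying by `e` on the left. -/
lemma powDeriv_succ' (e q : ℍ[ℝ]) (m : ℕ) :
    powDeriv e q (m + 1) = q * powDeriv e q m + e * q ^ m := by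
  induction m with
  | zero => simp [powDeriv]
  | succ m ih =>
    have h1 : powDeriv e q (m + 1 + 1) = powDeriv e q (m + 1) * q + q ^ (m + 1) * e := rfl
    have h2 : q * powDeriv e q (m + 1) = q * powDeriv e q m * q + q * q ^ m * e := by
      rw [show powDeriv e q (m + 1) = powDeriv e q m * q + q ^ m * e from rfl]
      noncomm_ring
    rw [h1, h2, ih, pow_succ' q m, add_mul, mul_assoc e, ← pow_succ, pow_succ' q m]
    abel

lemma hasDerivAt_line (q e : ℍ[ℝ]) (t : ℝ) : HasDerivAt (fun t : ℝ => q + t • e) e t := by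
  simpa using ((hasDerivAt_id t).smul_const e).const_add q

lemma hasDerivAt_pow_line (q e : ℍ[ℝ]) (m : ℕ) (t : ℝ) :
    HasDerivAt (fun t : ℝ => (q + t • e) ^ m) (powDeriv e (q + t • e) m) t := by
  induction m with
  | zero => simpa [powDeriv] using hasDerivAt_const t (1 : ℍ[ℝ])
  | succ m ih => 
    simp only [pow_succ, powDeriv]
    exact ih.mul (hasDerivAt_line q e t)

lemma hasDerivAt_powDeriv_line (q e : ℍ[ℝ]) (m : ℕ) (t : ℝ) :
    HasDerivAt (fun t : ℝ => powDeriv e (q + t • e) m) (powDeriv₂ e (q + t • e) m) t := by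
  induction m with
  | zero => simpa [powDeriv, powDeriv₂] using hasDerivAt_const t (0 : ℍ[ℝ])
  | succ m ih =>
    simp only [powDeriv_succ', powDeriv₂]
    convert! ((hasDerivAt_line q e t).mul ih).add
      ((hasDerivAt_pow_line q e m t).const_mul e) using 1
    rw [two_smul]; abel

lemma norm_powDeriv_le (e q : ℍ[ℝ]) {σ : ℝ} (hq : ‖q‖ ≤ σ) (m : ℕ) :
    σ * ‖powDeriv e q m‖ ≤ m * σ ^ m * ‖e‖ := by
  have hσ : 0 ≤ σ := (norm_nonneg q).trans hq
  induction m with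
  | zero => simp [powDeriv]
  | succ m ih =>
    have h1 : ‖powDeriv e q (m + 1)‖ ≤ ‖powDeriv e q m‖ * σ + σ ^ m * ‖e‖ := by
      rw [powDeriv]
      refine (norm_add_le _ _).trans ?_
      rw [norm_mul, norm_mul, norm_pow]
      gcongr
    calc σ * ‖powDeriv e q (m + 1)‖ ≤ σ * (‖powDeriv e q m‖ * σ + σ ^ m * ‖e‖) := by gcongr
      _ = (σ * ‖powDeriv e q m‖) * σ + σ ^ (m + 1) * ‖e‖ := by ring
      _ ≤ (m * σ ^ m * ‖e‖) * σ + σ ^ (m + 1) * ‖e‖ := by gcongr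
      _ = _ := by push_cast; ring

lemma norm_powDeriv₂_le (e q : ℍ[ℝ]) {σ : ℝ} (hq : ‖q‖ ≤ σ) (m : ℕ) :
    σ ^ 2 * ‖powDeriv₂ e q m‖ ≤ (m : ℝ) ^ 2 * σ ^ m * ‖e‖ ^ 2 := by
  have hσ : 0 ≤ σ := (norm_nonneg q).trans hq
  induction m with
  | zero => simp [powDeriv₂]
  | succ m ih =>
    have h1 : ‖powDeriv₂ e q (m + 1)‖ ≤ σ * ‖powDeriv₂ e q m‖ + 2 * (‖e‖ * ‖powDeriv e q m‖) := by
      rw [powDeriv₂]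
      refine (norm_add_le _ _).trans ?_
      rw [norm_mul, norm_smul, norm_mul]
      norm_num
      gcongr
    calc σ ^ 2 * ‖powDeriv₂ e q (m + 1)‖
        ≤ σ ^ 2 * (σ * ‖powDeriv₂ e q m‖ + 2 * (‖e‖ * ‖powDeriv e q m‖)) := by gcongr
      _ = σ * (σ ^ 2 * ‖powDeriv₂ e q m‖) + 2 * σ * ‖e‖ * (σ * ‖powDeriv e q m‖) := by ring
      _ ≤ σ * ((m : ℝ) ^ 2 * σ ^ m * ‖e‖ ^ 2) + 2 * σ * ‖e‖ * (m * σ ^ m * ‖e‖) := by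
        exact add_le_add (mul_le_mul_of_nonneg_left ih hσ)
          (mul_le_mul_of_nonneg_left (norm_powDeriv_le e q hq m) (by positivity))
      _ = ((m : ℝ) ^ 2 + 2 * m) * σ ^ (m + 1) * ‖e‖ ^ 2 := by ring
      _ ≤ _ := by
        gcongr
        push_cast
        nlinarith

/-- The sum of the power series `∑ q ^ j c j`. -/
noncomputable def qSeries (c : ℕ → ℍ[ℝ]) (q : ℍ[ℝ]) : ℍ[ℝ] := ∑' j : ℕ, q ^ j * c j

lemma summable_pow_mul {c : ℕ → ℍ[ℝ]} {ρ : ℝ} (hc : Summable fun j => ‖c j‖ * ρ ^ j)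
    {q : ℍ[ℝ]} (hq : ‖q‖ ≤ ρ) : Summable fun j => q ^ j * c j := by
  refine .of_norm_bounded hc fun j => ?_
  rw [norm_mul, norm_pow, mul_comm]
  gcongr

/-- Polynomial factors do no harm strictly inside the ball of convergence. -/
lemma summable_pow_mul_of_lt {c : ℕ → ℍ[ℝ]} {σ ρ : ℝ} (hσ : 0 ≤ σ) (hσρ : σ < ρ)
    (hc : Summable fun j => ‖c j‖ * ρ ^ j) (k : ℕ) :
    Summable fun j : ℕ => (j : ℝ) ^ k * σ ^ j * ‖c j‖ := by
  have hρ : 0 < ρ := hσ.trans_lt hσρ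
  have h1 : ‖σ / ρ‖ < 1 := by
    rw [Real.norm_of_nonneg (by positivity), div_lt_one hρ]; exact hσρ
  obtain ⟨C, hC⟩ :=
    (summable_pow_mul_geometric_of_norm_lt_one k h1).tendsto_atTop_zero.bddAbove_range
  refine .of_nonneg_of_le (fun j => by positivity) (fun j => ?_) (hc.mul_left C)
  have h2 : (j : ℝ) ^ k * (σ / ρ) ^ j ≤ C := hC ⟨j, rfl⟩
  calc (j : ℝ) ^ k * σ ^ j * ‖c j‖ = ((j : ℝ) ^ k * (σ / ρ) ^ j) * (‖c j‖ * ρ ^ j) := by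
        rw [div_pow]; field_simp
    _ ≤ _ := by gcongr

/-- A power series with right coefficients is real analytic on its ball of convergence. -/
lemma analyticOnNhd_qSeries {c : ℕ → ℍ[ℝ]} {ρ : ℝ} (hc : Summable fun j => ‖c j‖ * ρ ^ j) :
    AnalyticOnNhd ℝ (qSeries c) (Metric.ball 0 ρ) := by
  intro q hq
  rw [mem_ball_zero_iff] at hq
  have hρ : 0 < ρ := (norm_nonneg q).trans_lt hq
  let p : FormalMultilinearSeries ℝ ℍ[ℝ] ℍ[ℝ] := fun j =>
    ((ContinuousLinearMap.mul ℝ ℍ[ℝ]).flip (c j)).compContinuousMultilinearMap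
      (ContinuousMultilinearMap.mkPiAlgebraFin ℝ j ℍ[ℝ])
  have hp : ∀ j, ‖p j‖ ≤ ‖c j‖ := fun j => by
    refine ContinuousMultilinearMap.opNorm_le_bound (norm_nonneg _) fun m => ?_
    simp only [p, ContinuousLinearMap.compContinuousMultilinearMap_coe, Function.comp_apply,
      ContinuousLinearMap.flip_apply, ContinuousLinearMap.mul_apply', norm_mul]
    rw [mul_comm]
    gcongr
    simpa using (ContinuousMultilinearMap.mkPiAlgebraFin ℝ j ℍ[ℝ]).le_opNorm m
  have hr : ENNReal.ofReal ρ ≤ p.radius := by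
    obtain ⟨r, rfl⟩ : ∃ r : NNReal, (r : ℝ) = ρ := ⟨⟨ρ, hρ.le⟩, rfl⟩
    rw [ENNReal.ofReal_coe_nnreal]
    refine p.le_radius_of_summable_norm (.of_nonneg_of_le (fun j => by positivity) (fun j => ?_) hc)
    gcongr
    exact hp j
  have hfun : qSeries c = p.sum := by
    ext1 x
    simp [qSeries, FormalMultilinearSeries.sum, p]
  rw [hfun]
  have hball := p.hasFPowerSeriesOnBall ((ENNReal.ofReal_pos.2 hρ).trans_le hr)
  refine hball.analyticAt_of_mem ?_
  refine Metric.eball_subset_eball hr ?_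
  rwa [Metric.eball_ofReal, mem_ball_zero_iff]

/-- A power series may be differentiated twice termwise along a line. -/
lemma hasDerivAt_qSeries_line {c : ℕ → ℍ[ℝ]} {ρ : ℝ} (hc : Summable fun j => ‖c j‖ * ρ ^ j)
    {q : ℍ[ℝ]} (hq : ‖q‖ < ρ) (e : ℍ[ℝ]) :
    HasDerivAt (fun t : ℝ => qSeries c (q + t • e)) (∑' j, powDeriv e q j * c j) 0 ∧
      (Summable fun j => powDeriv₂ e q j * c j) ∧
      HasDerivAt (fun t : ℝ => ∑' j, powDeriv e (q + t • e) j * c j)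
        (∑' j, powDeriv₂ e q j * c j) 0 := by
  obtain ⟨σ, hqσ, hσρ⟩ := exists_between hq
  have hσ : 0 < σ := (norm_nonneg q).trans_lt hqσ
  let T : Set ℝ := (fun t : ℝ => q + t • e) ⁻¹' Metric.ball 0 σ
  have hTo : IsOpen T := Metric.isOpen_ball.preimage (by fun_prop)
  have hTc : IsPreconnected T := by
    have : T = (AffineMap.lineMap q (q + e) : ℝ →ᵃ[ℝ] ℍ[ℝ]) ⁻¹' Metric.ball 0 σ := by
      ext t; simp [T, AffineMap.lineMap_apply, add_comm]
    rw [this]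
    exact ((convex_ball _ _).affine_preimage _).isPreconnected
  have h0 : (0 : ℝ) ∈ T := by simpa [T] using hqσ
  have hT : ∀ t ∈ T, ‖q + t • e‖ ≤ σ := fun t ht => (mem_ball_zero_iff.1 ht).le
  have b1 : ∀ p : ℍ[ℝ], ‖p‖ ≤ σ → ∀ j,
      ‖powDeriv e p j * c j‖ ≤ (σ⁻¹ * ‖e‖) * ((j : ℝ) ^ 1 * σ ^ j * ‖c j‖) := fun p hp j => by
    rw [norm_mul]
    have := norm_powDeriv_le e p hp j
    calc ‖powDeriv e p j‖ * ‖c j‖ = σ⁻¹ * (σ * ‖powDeriv e p j‖) * ‖c j‖ := by field_simp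
      _ ≤ σ⁻¹ * (j * σ ^ j * ‖e‖) * ‖c j‖ := by gcongr
      _ = _ := by ring
  have b2 : ∀ p : ℍ[ℝ], ‖p‖ ≤ σ → ∀ j,
      ‖powDeriv₂ e p j * c j‖ ≤ ((σ ^ 2)⁻¹ * ‖e‖ ^ 2) * ((j : ℝ) ^ 2 * σ ^ j * ‖c j‖) :=
    fun p hp j => by
    rw [norm_mul]
    have := norm_powDeriv₂_le e p hp j
    calc ‖powDeriv₂ e p j‖ * ‖c j‖ = (σ ^ 2)⁻¹ * (σ ^ 2 * ‖powDeriv₂ e p j‖) * ‖c j‖ := by field_simp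
      _ ≤ (σ ^ 2)⁻¹ * ((j : ℝ) ^ 2 * σ ^ j * ‖e‖ ^ 2) * ‖c j‖ := by gcongr
      _ = _ := by ring
  have s1 := (summable_pow_mul_of_lt hσ.le hσρ hc 1).mul_left (σ⁻¹ * ‖e‖)
  have s2 := (summable_pow_mul_of_lt hσ.le hσρ hc 2).mul_left ((σ ^ 2)⁻¹ * ‖e‖ ^ 2)
  refine ⟨?_, .of_norm_bounded s2 (b2 q hqσ.le), ?_⟩
  · have := hasDerivAt_tsum_of_isPreconnected s1 hTo hTc
      (fun j t _ => (hasDerivAt_pow_line q e j t).mul_const (c j))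
      (fun j t ht => b1 _ (hT t ht) j) h0
      (by simpa using summable_pow_mul hc hq.le) h0
    simpa [qSeries] using this
  · have := hasDerivAt_tsum_of_isPreconnected s2 hTo hTc
      (fun j t _ => (hasDerivAt_powDeriv_line q e j t).mul_const (c j))
      (fun j t ht => b2 _ (hT t ht) j) h0
      (by simpa using Summable.of_norm_bounded s1 (b1 q hqσ.le)) h0
    simpa using this

/-! ### The Laplacian of a power series -/

/-- The orthonormal basis `1, i, j, k` of the quaternions. -/
noncomputable def quaternionBasis : OrthonormalBasis (Fin 4) ℝ ℍ[ℝ] :=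
  (EuclideanSpace.basisFun (Fin 4) ℝ).map Quaternion.linearIsometryEquivTuple.symm

/-- This identity turns the sum of second derivatives of `q ^ m` into powers of `q` and `star q`. -/
lemma sum_quaternionBasis_mul_mul (x : ℍ[ℝ]) :
    ∑ i, quaternionBasis i * x * quaternionBasis i = (-2 : ℝ) • star x := by
  have h0 : (quaternionBasis 0).re = 1 ∧ (quaternionBasis 0).imI = 0 ∧
      (quaternionBasis 0).imJ = 0 ∧ (quaternionBasis 0).imK = 0 := by
    simp [quaternionBasis]
  have h1 : (quaternionBasis 1).re = 0 ∧ (quaternionBasis 1).imI = 1 ∧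
      (quaternionBasis 1).imJ = 0 ∧ (quaternionBasis 1).imK = 0 := by
    simp [quaternionBasis]
  have h2 : (quaternionBasis 2).re = 0 ∧ (quaternionBasis 2).imI = 0 ∧
      (quaternionBasis 2).imJ = 1 ∧ (quaternionBasis 2).imK = 0 := by
    simp [quaternionBasis]
  have h3 : (quaternionBasis 3).re = 0 ∧ (quaternionBasis 3).imI = 0 ∧
      (quaternionBasis 3).imJ = 0 ∧ (quaternionBasis 3).imK = 1 := by
    simp [quaternionBasis]
  rw [Fin.sum_univ_four]
  ext <;> simp [h0, h1, h2, h3] <;> ring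

/-- The cross terms in the second derivative of `q ^ (m + 1) = q * q ^ m`, summed over the basis. -/
lemma sum_quaternionBasis_mul_powDeriv (q : ℍ[ℝ]) (m : ℕ) :
    ∑ i, quaternionBasis i * powDeriv (quaternionBasis i) q m =
      (-2 : ℝ) • ∑ j ∈ Finset.range m, q ^ (m - 1 - j) * star q ^ j := by
  have hcomm : ∀ j k : ℕ, q ^ k * star q ^ j = star q ^ j * q ^ k := fun j k =>
    ((show Commute q (star q) from (star_comm_self' q).symm).pow_pow k j).eq
  induction m with
  | zero => simp [powDeriv]
  | succ m ih =>
    have h : ∀ i, quaternionBasis i * powDeriv (quaternionBasis i) q (m + 1) =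
        (quaternionBasis i * powDeriv (quaternionBasis i) q m) * q +
          quaternionBasis i * q ^ m * quaternionBasis i := fun i => by
      rw [powDeriv]; noncomm_ring
    simp only [h, Finset.sum_add_distrib, ← Finset.sum_mul, ih, sum_quaternionBasis_mul_mul]
    rw [Finset.sum_range_succ, smul_add, star_pow]
    congr 1
    · rw [smul_mul_assoc, Finset.sum_mul]
      congr 1
      refine Finset.sum_congr rfl fun j hj => ?_
      have : m + 1 - 1 - j = (m - 1 - j) + 1 := by have := Finset.mem_range.1 hj; omega
      rw [this, hcomm, hcomm, mul_assoc, ← pow_succ]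
    · simp

/-- `Δ (q ^ (s + 2)) = -2 (s + 1) (s + 2) Q_s`. -/
lemma sum_powDeriv₂ (q : ℍ[ℝ]) (s : ℕ) :
    ∑ i, powDeriv₂ (quaternionBasis i) q (s + 2) =
      (-2 * ((s : ℝ) + 1) * ((s : ℝ) + 2)) • appellQ s q := by
  have key : ∑ i, powDeriv₂ (quaternionBasis i) q (s + 2) =
      (-4 : ℝ) • ∑ j ∈ Finset.range (s + 1), ((s : ℝ) - j + 1) • (q ^ (s - j) * star q ^ j) := by
    induction s with
    | zero =>
      have h := sum_quaternionBasis_mul_powDeriv q 1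
      simp only [powDeriv₂, mul_zero, Finset.sum_add_distrib, ← Finset.mul_sum, ← Finset.smul_sum]
      rw [h]
      simp [powDeriv, smul_smul]
      norm_num
    | succ s ih =>
      have h := sum_quaternionBasis_mul_powDeriv q (s + 2)
      simp only [powDeriv₂.eq_2 _ _ (s + 2), Finset.sum_add_distrib, ← Finset.mul_sum,
        ← Finset.smul_sum]
      rw [ih, h, smul_smul, mul_smul_comm, Finset.mul_sum, Finset.sum_range_succ _ (s + 1),
        Finset.sum_range_succ _ (s + 1), smul_add, smul_add, ← add_assoc,
        Finset.smul_sum, Finset.smul_sum, Finset.smul_sum, ← Finset.sum_add_distrib]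
      congr 1
      · refine Finset.sum_congr rfl fun j hj => ?_
        have e1 : s + 2 - 1 - j = s + 1 - j := by omega
        have e2 : s + 1 - j = (s - j) + 1 := by have := Finset.mem_range.1 hj; omega
        rw [e1, e2, mul_smul_comm, ← mul_assoc, ← pow_succ', smul_smul, smul_smul, ← add_smul]
        congr 1
        push_cast; ring
      · have : s + 2 - 1 - (s + 1) = s + 1 - (s + 1) := by omega
        rw [this, smul_smul]
        congr 1
        push_cast; ring
  rw [key, appellQ, Finset.smul_sum, Finset.smul_sum]
  refine Finset.sum_congr rfl fun j _ => ?_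
  rw [smul_smul, smul_smul]
  congr 1
  field_simp
  ring

/-- A power series may be differentiated twice termwise, so its Laplacian is a series of
Appell polynomials. -/
theorem laplacian_qSeries {c : ℕ → ℍ[ℝ]} {ρ : ℝ} (hc : Summable fun j => ‖c j‖ * ρ ^ j)
    {q : ℍ[ℝ]} (hq : ‖q‖ < ρ) :
    HasSum (fun s : ℕ => appellQ s q * ((-2 * ((s : ℝ) + 1) * ((s : ℝ) + 2)) • c (s + 2)))
      (Laplacian.laplacian (qSeries c) q) := by
  have han := analyticOnNhd_qSeries hc
  have hq' : q ∈ Metric.ball (0 : ℍ[ℝ]) ρ := mem_ball_zero_iff.2 hq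
  have second : ∀ e : ℍ[ℝ], iteratedFDeriv ℝ 2 (qSeries c) q ![e, e] =
      ∑' j, powDeriv₂ e q j * c j := fun e => by
    rw [iteratedFDeriv_two_apply]
    simp only [Matrix.cons_val_zero, Matrix.cons_val_one]
    have h1 : HasDerivAt (fun t : ℝ => fderiv ℝ (qSeries c) (q + t • e) e)
        (fderiv ℝ (fderiv ℝ (qSeries c)) q e e) 0 := by
      have hd : HasDerivAt (fun t : ℝ => fderiv ℝ (qSeries c) (q + t • e))
          (fderiv ℝ (fderiv ℝ (qSeries c)) q e) 0 :=
        (han.fderiv q hq').differentiableAt.hasFDerivAt.hasLineDerivAt e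
      simpa using hd.clm_apply (hasDerivAt_const (0 : ℝ) e)
    have h2 : (fun t : ℝ => fderiv ℝ (qSeries c) (q + t • e) e) =ᶠ[nhds 0]
        fun t : ℝ => ∑' j, powDeriv e (q + t • e) j * c j := by
      have hcont : Filter.Tendsto (fun t : ℝ => q + t • e) (nhds 0) (nhds q) := by
        have : Continuous fun t : ℝ => q + t • e := by fun_prop
        simpa using this.tendsto 0
      filter_upwards [hcont (Metric.isOpen_ball.mem_nhds hq')] with t ht
      have ht' : q + t • e ∈ Metric.ball (0 : ℍ[ℝ]) ρ := ht
      exact ((han _ ht').differentiableAt.hasFDerivAt.hasLineDerivAt e).unique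
        (hasDerivAt_qSeries_line hc (mem_ball_zero_iff.1 ht') e).1
    exact h1.unique ((hasDerivAt_qSeries_line hc hq e).2.2.congr_of_eventuallyEq h2)
  rw [InnerProductSpace.laplacian_eq_iteratedFDeriv_orthonormalBasis _ quaternionBasis]
  simp only [second]
  have hs : HasSum (fun j => ∑ i, powDeriv₂ (quaternionBasis i) q j * c j)
      (∑ i, ∑' j, powDeriv₂ (quaternionBasis i) q j * c j) :=
    hasSum_sum fun i _ => (hasDerivAt_qSeries_line hc hq (quaternionBasis i)).2.1.hasSum
  rw [← hasSum_nat_add_iff' 2] at hs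
  convert! hs using 1
  · ext1 s
    rw [← Finset.sum_mul, sum_powDeriv₂, smul_mul_assoc, mul_smul_comm]
  · simp [Finset.sum_range_succ, powDeriv₂, powDeriv]

/-! ### The slices and the representation formula -/


lemma mul_self_of_mem_imagUnits {I : ℍ[ℝ]} (hI : I ∈ imagUnits) : I * I = -1 := by
  rw [← sq]; exact hI

lemma neg_mem_imagUnits {I : ℍ[ℝ]} (hI : I ∈ imagUnits) : -I ∈ imagUnits := by
  simpa [imagUnits] using hI

lemma re_eq_zero_of_mem_imagUnits {I : ℍ[ℝ]} (hI : I ∈ imagUnits) : I.re = 0 := by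
  have h := mul_self_of_mem_imagUnits hI
  have h0 := congrArg (fun q : ℍ[ℝ] => q.re) h
  have h1 := congrArg (fun q : ℍ[ℝ] => q.imI) h
  have h2 := congrArg (fun q : ℍ[ℝ] => q.imJ) h
  have h3 := congrArg (fun q : ℍ[ℝ] => q.imK) h
  simp only [Quaternion.re_mul, Quaternion.imI_mul, Quaternion.imJ_mul, Quaternion.imK_mul,
    Quaternion.re_neg, Quaternion.imI_neg, Quaternion.imJ_neg, Quaternion.imK_neg,
    Quaternion.re_one, Quaternion.imI_one, Quaternion.imJ_one, Quaternion.imK_one] at h0 h1 h2 h3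
  by_contra hre
  have e1 : I.imI = 0 := by
    have : I.re * I.imI = 0 := by linarith
    exact (mul_eq_zero.1 this).resolve_left hre
  have e2 : I.imJ = 0 := by
    have : I.re * I.imJ = 0 := by linarith
    exact (mul_eq_zero.1 this).resolve_left hre
  have e3 : I.imK = 0 := by
    have : I.re * I.imK = 0 := by linarith
    exact (mul_eq_zero.1 this).resolve_left hre
  rw [e1, e2, e3] at h0
  nlinarith [mul_self_nonneg I.re]

lemma star_of_mem_imagUnits {I : ℍ[ℝ]} (hI : I ∈ imagUnits) : star I = -I :=
  Quaternion.star_eq_neg.2 (re_eq_zero_of_mem_imagUnits hI)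

lemma norm_of_mem_imagUnits {I : ℍ[ℝ]} (hI : I ∈ imagUnits) : ‖I‖ = 1 := by
  have h : ‖I‖ ^ 2 = 1 := by rw [← norm_pow, show I ^ 2 = -1 from hI, norm_neg, norm_one]
  exact (pow_eq_one_iff_of_nonneg (norm_nonneg I) two_ne_zero).1 h

/-- The embedding `x + i y ↦ x + I y` of `ℂ` onto the slice `ℝ + ℝ I`. -/
noncomputable def sliceHom (I : ℍ[ℝ]) (hI : I ∈ imagUnits) : ℂ →ₐ[ℝ] ℍ[ℝ] :=
  Complex.liftAux I (mul_self_of_mem_imagUnits hI)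

lemma sliceHom_apply {I : ℍ[ℝ]} (hI : I ∈ imagUnits) (z : ℂ) :
    sliceHom I hI z = slicePoint I z.re z.im := Complex.liftAux_apply _ _ _

lemma sliceHom_mk {I : ℍ[ℝ]} (hI : I ∈ imagUnits) (x y : ℝ) :
    sliceHom I hI ⟨x, y⟩ = slicePoint I x y := sliceHom_apply hI _

@[simp] lemma sliceHom_I {I : ℍ[ℝ]} (hI : I ∈ imagUnits) : sliceHom I hI Complex.I = I := by
  simp [sliceHom_apply, slicePoint]

@[simp] lemma sliceHom_ofReal {I : ℍ[ℝ]} (hI : I ∈ imagUnits) (x : ℝ) :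
    sliceHom I hI (x : ℂ) = (x : ℍ[ℝ]) := by
  simp [sliceHom]

lemma star_sliceHom {I : ℍ[ℝ]} (hI : I ∈ imagUnits) (z : ℂ) :
    star (sliceHom I hI z) = sliceHom I hI (conj z) := by
  simp [sliceHom_apply, slicePoint, star_of_mem_imagUnits hI]

lemma norm_sliceHom {I : ℍ[ℝ]} (hI : I ∈ imagUnits) (z : ℂ) : ‖sliceHom I hI z‖ = ‖z‖ := by
  have h : ‖sliceHom I hI z‖ ^ 2 = ‖z‖ ^ 2 := by
    have h1 : sliceHom I hI z * star (sliceHom I hI z) = ((‖z‖ ^ 2 : ℝ) : ℍ[ℝ]) := by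
      rw [star_sliceHom, ← map_mul, Complex.mul_conj, Complex.normSq_eq_norm_sq, sliceHom_ofReal]
    have h2 := congrArg norm h1
    rw [norm_mul, Quaternion.norm_star, Quaternion.norm_coe, ← sq] at h2
    rw [h2, Real.norm_of_nonneg (by positivity)]
  exact (pow_left_inj₀ (norm_nonneg _) (norm_nonneg _) two_ne_zero).1 h

lemma continuous_sliceHom {I : ℍ[ℝ]} (hI : I ∈ imagUnits) : Continuous (sliceHom I hI) :=
  (sliceHom I hI).toLinearMap.continuous_of_finiteDimensional

/-- The imaginary unit `i`. -/
noncomputable def unitI : ℍ[ℝ] := ((Complex.I : ℂ) : ℍ[ℝ])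

lemma unitI_mem : unitI ∈ imagUnits := by
  change unitI ^ 2 = -1
  rw [sq, unitI, ← Quaternion.coeComplex_mul, Complex.I_mul_I]
  ext <;> simp

@[simp] lemma unitI_mul_unitI_mul (q : ℍ[ℝ]) : unitI * (unitI * q) = -q := by
  rw [← mul_assoc, mul_self_of_mem_imagUnits unitI_mem, neg_one_mul]

lemma mul_mul_of_mem_imagUnits {I : ℍ[ℝ]} (hI : I ∈ imagUnits) (q : ℍ[ℝ]) :
    I * (I * q) = -q := by
  rw [← mul_assoc, mul_self_of_mem_imagUnits hI, neg_one_mul]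

/-- The point `x + i |y|` of the upper half plane that represents `x + I y`. -/
noncomputable def sliceCoord (q : ℍ[ℝ]) : ℂ := ⟨q.re, ‖q.im‖⟩

/-- The direction of the imaginary part; it is `0` at real points. -/
noncomputable def imDir (q : ℍ[ℝ]) : ℍ[ℝ] := ‖q.im‖⁻¹ • q.im

lemma exists_slicePoint (q : ℍ[ℝ]) : ∃ I ∈ imagUnits, ∃ x y : ℝ, q = slicePoint I x y := by
  by_cases h : q.im = 0
  · refine ⟨unitI, unitI_mem, q.re, 0, ?_⟩
    rw [slicePoint, zero_smul, add_zero]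
    conv_lhs => rw [← Quaternion.re_add_im q, h, add_zero]
  · have hn : ‖q.im‖ ≠ 0 := norm_ne_zero_iff.2 h
    refine ⟨imDir q, ?_, q.re, ‖q.im‖, ?_⟩
    · change imDir q ^ 2 = -1
      have h1 : q.im ^ 2 = -((‖q.im‖ ^ 2 : ℝ) : ℍ[ℝ]) := by
        have h2 : q.im * star q.im = ((‖q.im‖ ^ 2 : ℝ) : ℍ[ℝ]) := by
          rw [Quaternion.self_mul_star, Quaternion.normSq_eq_norm_mul_self, sq]
        rw [Quaternion.star_im, mul_neg] at h2
        rw [sq, ← h2, neg_neg]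
      rw [imDir, smul_pow, h1, ← Quaternion.coe_neg, ← Quaternion.coe_smul, smul_eq_mul]
      rw [show ‖q.im‖⁻¹ ^ 2 * -‖q.im‖ ^ 2 = -1 by field_simp]
      simp
    · rw [slicePoint, imDir, smul_smul, mul_inv_cancel₀ hn, one_smul, Quaternion.re_add_im]

/-- The slice extension of a function on the slice `ℝ + ℝ i`, given by the representation
formula. -/
noncomputable def sliceExt (φ : ℂ → ℍ[ℝ]) (q : ℍ[ℝ]) : ℍ[ℝ] :=
  (1 / 2 : ℝ) • (φ (sliceCoord q) + φ (conj (sliceCoord q))) -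
    (1 / 2 : ℝ) • (imDir q * (unitI * (φ (sliceCoord q) - φ (conj (sliceCoord q)))))

lemma re_slicePoint {I : ℍ[ℝ]} (hI : I ∈ imagUnits) (x y : ℝ) : (slicePoint I x y).re = x := by
  simp [slicePoint, re_eq_zero_of_mem_imagUnits hI]

lemma im_slicePoint {I : ℍ[ℝ]} (hI : I ∈ imagUnits) (x y : ℝ) :
    (slicePoint I x y).im = y • I := by
  have : I.im = I := by
    conv_rhs => rw [← Quaternion.re_add_im I, re_eq_zero_of_mem_imagUnits hI]
    simp
  simp [slicePoint, this]

lemma sliceExt_slicePoint (φ : ℂ → ℍ[ℝ]) {I : ℍ[ℝ]} (hI : I ∈ imagUnits) (x y : ℝ) :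
    sliceExt φ (slicePoint I x y) = (1 / 2 : ℝ) • (φ ⟨x, y⟩ + φ ⟨x, -y⟩) -
      (1 / 2 : ℝ) • (I * (unitI * (φ ⟨x, y⟩ - φ ⟨x, -y⟩))) := by
  have hconj : ∀ u v : ℝ, conj (⟨u, v⟩ : ℂ) = ⟨u, -v⟩ := fun u v => rfl
  rw [sliceExt, imDir, sliceCoord, re_slicePoint hI, im_slicePoint hI, norm_smul,
    norm_of_mem_imagUnits hI, mul_one, Real.norm_eq_abs, smul_smul, hconj]
  rcases lt_trichotomy y 0 with h | rfl | h
  · rw [abs_of_neg h, neg_neg, show (-y)⁻¹ * y = -1 by rw [inv_neg, neg_mul, inv_mul_cancel₀ h.ne]]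
    rw [neg_one_smul, add_comm (φ _), ← neg_sub (φ ⟨x, y⟩), mul_neg, neg_mul_neg]
  · simp
  · rw [abs_of_pos h, inv_mul_cancel₀ h.ne', one_smul]

lemma sliceExt_sliceHom (φ : ℂ → ℍ[ℝ]) {I : ℍ[ℝ]} (hI : I ∈ imagUnits) (z : ℂ) :
    sliceExt φ (sliceHom I hI z) = (1 / 2 : ℝ) • (φ z + φ (conj z)) -
      (1 / 2 : ℝ) • (I * (unitI * (φ z - φ (conj z)))) := by
  rw [sliceHom_apply, sliceExt_slicePoint φ hI]
  rfl

lemma sliceExt_unitI (φ : ℂ → ℍ[ℝ]) (z : ℂ) : sliceExt φ (sliceHom unitI unitI_mem z) = φ z := by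
  rw [sliceExt_sliceHom, unitI_mul_unitI_mul]
  module

lemma isSliceFunction_sliceExt (Ω : Set ℍ[ℝ]) (φ : ℂ → ℍ[ℝ]) :
    IsSliceFunction Ω (sliceExt φ) := by
  refine ⟨fun x y => (1 / 2 : ℝ) • (φ ⟨x, y⟩ + φ ⟨x, -y⟩),
    fun x y => (-1 / 2 : ℝ) • (unitI * (φ ⟨x, y⟩ - φ ⟨x, -y⟩)), fun x y => ?_, fun x y => ?_,
    fun I hI x y _ => ?_⟩
  · simp only [neg_neg, add_comm]
  · simp only [neg_neg]
    rw [← neg_sub (φ ⟨x, y⟩), mul_neg, smul_neg]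
  · rw [sliceExt_slicePoint φ hI, mul_smul_comm]
    module

/-- The trace of `Ω` on the slice `ℝ + ℝ i`, as a subset of `ℂ`. -/
def sliceTrace (Ω : Set ℍ[ℝ]) : Set ℂ := {z | slicePoint unitI z.re z.im ∈ Ω}

lemma slicePoint_neg (I : ℍ[ℝ]) (x y : ℝ) : slicePoint I x (-y) = slicePoint (-I) x y := by
  simp [slicePoint]

lemma IsAxiallySymmetric.slicePoint_mem_iff {Ω : Set ℍ[ℝ]} (hΩ : IsAxiallySymmetric Ω)
    {I : ℍ[ℝ]} (hI : I ∈ imagUnits) (x y : ℝ) :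
    slicePoint I x y ∈ Ω ↔ (⟨x, y⟩ : ℂ) ∈ sliceTrace Ω :=
  ⟨hΩ x y I hI _ unitI_mem, hΩ x y _ unitI_mem I hI⟩

lemma IsAxiallySymmetric.sliceHom_mem_iff {Ω : Set ℍ[ℝ]} (hΩ : IsAxiallySymmetric Ω)
    {I : ℍ[ℝ]} (hI : I ∈ imagUnits) (z : ℂ) :
    sliceHom I hI z ∈ Ω ↔ z ∈ sliceTrace Ω := by
  rw [sliceHom_apply]; exact hΩ.slicePoint_mem_iff hI _ _

lemma IsAxiallySymmetric.conj_mem {Ω : Set ℍ[ℝ]} (hΩ : IsAxiallySymmetric Ω) {z : ℂ}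
    (hz : z ∈ sliceTrace Ω) : conj z ∈ sliceTrace Ω := by
  have h : slicePoint (-unitI) z.re z.im ∈ Ω :=
    (hΩ.slicePoint_mem_iff (neg_mem_imagUnits unitI_mem) _ _).2 hz
  rw [← slicePoint_neg] at h
  exact h

lemma isOpen_sliceTrace {Ω : Set ℍ[ℝ]} (hΩ : IsOpen Ω) : IsOpen (sliceTrace Ω) := by
  have : sliceTrace Ω = sliceHom unitI unitI_mem ⁻¹' Ω := by
    ext z; simp [sliceTrace, sliceHom_apply]
  rw [this]
  exact hΩ.preimage (continuous_sliceHom unitI_mem)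

/-- The representation formula: a slice function is the slice extension of its restriction to
one slice. -/
lemma IsSliceFunction.eqOn_sliceExt {Ω : Set ℍ[ℝ]} (hΩ : IsAxiallySymmetric Ω)
    {f : ℍ[ℝ] → ℍ[ℝ]} (hf : IsSliceFunction Ω f) {φ : ℂ → ℍ[ℝ]}
    (h : ∀ z ∈ sliceTrace Ω, f (sliceHom unitI unitI_mem z) = φ z) :
    Set.EqOn f (sliceExt φ) Ω := by
  intro q hq
  obtain ⟨I, hI, x, y, rfl⟩ := exists_slicePoint q
  obtain ⟨a, b, ha, hb, hab⟩ := hf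
  have hz : (⟨x, y⟩ : ℂ) ∈ sliceTrace Ω := (hΩ.slicePoint_mem_iff hI x y).1 hq
  have hz' : (⟨x, -y⟩ : ℂ) ∈ sliceTrace Ω := hΩ.conj_mem hz
  have e1 := h _ hz
  have e2 := h _ hz'
  rw [sliceHom_mk, hab _ unitI_mem x _ hz] at e1
  rw [sliceHom_mk, hab _ unitI_mem x _ hz', ha, hb] at e2
  rw [sliceExt_slicePoint φ hI, hab I hI x y hq, ← e1, ← e2, mul_neg]
  have e3 : a x y + unitI * b x y - (a x y + -(unitI * b x y)) =
      (2 : ℝ) • (unitI * b x y) := by module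
  rw [e3, mul_smul_comm, unitI_mul_unitI_mul, mul_smul_comm, mul_neg]
  module

lemma IsSliceFunction.eqOn {Ω : Set ℍ[ℝ]} (hΩ : IsAxiallySymmetric Ω) {f g : ℍ[ℝ] → ℍ[ℝ]}
    (hf : IsSliceFunction Ω f) (hg : IsSliceFunction Ω g)
    (h : ∀ z ∈ sliceTrace Ω,
      f (sliceHom unitI unitI_mem z) = g (sliceHom unitI unitI_mem z)) : Set.EqOn f g Ω :=
  (hf.eqOn_sliceExt hΩ h).trans (hg.eqOn_sliceExt hΩ fun _ _ => rfl).symm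

lemma IsSliceFunction.mono {Ω U : Set ℍ[ℝ]} {f : ℍ[ℝ] → ℍ[ℝ]} (hf : IsSliceFunction Ω f)
    (h : U ⊆ Ω) : IsSliceFunction U f := by
  obtain ⟨a, b, ha, hb, hab⟩ := hf
  exact ⟨a, b, ha, hb, fun I hI x y hq => hab I hI x y (h hq)⟩

lemma IsSliceFunction.congr {Ω : Set ℍ[ℝ]} {f g : ℍ[ℝ] → ℍ[ℝ]} (hf : IsSliceFunction Ω f)
    (h : Set.EqOn g f Ω) : IsSliceFunction Ω g := by
  obtain ⟨a, b, ha, hb, hab⟩ := hf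
  exact ⟨a, b, ha, hb, fun I hI x y hq => (h hq).trans (hab I hI x y hq)⟩

lemma isSliceFunction_sum {ι : Type*} (s : Finset ι) {Ω : Set ℍ[ℝ]} {f : ι → ℍ[ℝ] → ℍ[ℝ]}
    (hf : ∀ i, IsSliceFunction Ω (f i)) : IsSliceFunction Ω fun q => ∑ i ∈ s, f i q := by
  choose a b ha hb hab using hf
  refine ⟨fun x y => ∑ i ∈ s, a i x y, fun x y => ∑ i ∈ s, b i x y, fun x y => ?_, fun x y => ?_,
    fun I hI x y hq => ?_⟩
  · simp only [ha]
  · simp only [hb, Finset.sum_neg_distrib]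
  · rw [Finset.mul_sum, ← Finset.sum_add_distrib]
    exact Finset.sum_congr rfl fun i _ => hab i I hI x y hq

lemma IsSliceFunction.star_pow_mul {Ω : Set ℍ[ℝ]} {f : ℍ[ℝ] → ℍ[ℝ]} (hf : IsSliceFunction Ω f)
    (k : ℕ) : IsSliceFunction Ω fun q => star q ^ k * f q := by
  obtain ⟨a, b, ha, hb, hab⟩ := hf
  have hc : ∀ x y : ℝ, (⟨x, -y⟩ : ℂ) ^ k = conj ((⟨x, y⟩ : ℂ) ^ k) := fun x y => by
    rw [map_pow]; rfl
  refine ⟨fun x y => ((⟨x, y⟩ : ℂ) ^ k).re • a x y + ((⟨x, y⟩ : ℂ) ^ k).im • b x y,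
    fun x y => ((⟨x, y⟩ : ℂ) ^ k).re • b x y - ((⟨x, y⟩ : ℂ) ^ k).im • a x y,
    fun x y => ?_, fun x y => ?_, fun I hI x y hq => ?_⟩
  · simp only [hc, ha, hb, Complex.conj_re, Complex.conj_im, smul_neg, neg_smul, neg_neg]
  · simp only [hc, ha, hb, Complex.conj_re, Complex.conj_im, smul_neg, neg_smul]
    abel
  · simp only [hab I hI x y hq]
    rw [← sliceHom_mk hI, star_sliceHom, ← map_pow, ← map_pow, sliceHom_apply, slicePoint,
      Complex.conj_re, Complex.conj_im, add_mul, Quaternion.coe_mul_eq_smul, smul_mul_assoc,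
      mul_add I, mul_mul_of_mem_imagUnits hI, mul_sub, mul_smul_comm, mul_smul_comm]
    module

/-- A power series with quaternionic right coefficients is a slice function. -/
lemma isSliceFunction_qSeries {c : ℕ → ℍ[ℝ]} {Ω : Set ℍ[ℝ]}
    (hc : ∀ q ∈ Ω, Summable fun j => ‖c j‖ * ‖q‖ ^ j) : IsSliceFunction Ω (qSeries c) := by
  have hconj : ∀ (x y : ℝ) (j : ℕ), (⟨x, -y⟩ : ℂ) ^ j = conj ((⟨x, y⟩ : ℂ) ^ j) := fun x y j => by
    rw [map_pow]; rfl
  refine ⟨fun x y => ∑' j, ((⟨x, y⟩ : ℂ) ^ j).re • c j, fun x y => ∑' j, ((⟨x, y⟩ : ℂ) ^ j).im • c j,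
    fun x y => ?_, fun x y => ?_, fun I hI x y hq => ?_⟩
  · simp only [hconj, Complex.conj_re]
  · simp only [hconj, Complex.conj_im, neg_smul, tsum_neg]
  · have hs := hc _ hq
    rw [← sliceHom_mk hI, norm_sliceHom] at hs
    have hre : Summable fun j => ((⟨x, y⟩ : ℂ) ^ j).re • c j := by
      refine .of_norm_bounded hs fun j => ?_
      rw [norm_smul, mul_comm, ← norm_pow]
      gcongr
      exact Complex.abs_re_le_norm _
    have him : Summable fun j => ((⟨x, y⟩ : ℂ) ^ j).im • c j := by
      refine .of_norm_bounded hs fun j => ?_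
      rw [norm_smul, mul_comm, ← norm_pow]
      gcongr
      exact Complex.abs_im_le_norm _
    rw [qSeries, ← him.tsum_mul_left, ← hre.tsum_add (him.mul_left I)]
    refine tsum_congr fun j => ?_
    rw [← sliceHom_mk hI, ← map_pow, sliceHom_apply, slicePoint, add_mul,
      Quaternion.coe_mul_eq_smul, smul_mul_assoc, mul_smul_comm]

/-! ### The Cauchy-Riemann operator on a slice -/

/-- The operator `(1/2) (∂/∂x + I ∂/∂y)` on quaternion valued functions of a complex variable. -/
noncomputable def dbarC (I : ℍ[ℝ]) (φ : ℂ → ℍ[ℝ]) (z : ℂ) : ℍ[ℝ] :=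
  (1 / 2 : ℝ) • (lineDeriv ℝ φ z 1 + I * lineDeriv ℝ φ z Complex.I)

lemma dbar_comp_sliceHom {I : ℍ[ℝ]} (hI : I ∈ imagUnits) (f : ℍ[ℝ] → ℍ[ℝ]) :
    dbar I f ∘ sliceHom I hI = dbarC I (f ∘ sliceHom I hI) := by
  ext1 z
  simp only [dbar, dbarC, lineDeriv, Function.comp_apply, map_add, map_smul, map_one, sliceHom_I]

/-- Restricting to a slice intertwines the iterates of the two operators; no differentiability is
involved, as the line derivatives are taken along the slice. -/
lemma dbar_iterate_comp_sliceHom {I : ℍ[ℝ]} (hI : I ∈ imagUnits) (f : ℍ[ℝ] → ℍ[ℝ]) (m : ℕ) :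
    (dbar I)^[m] f ∘ sliceHom I hI = (dbarC I)^[m] (f ∘ sliceHom I hI) := by
  induction m with
  | zero => rfl
  | succ m ih => rw [Function.iterate_succ_apply', Function.iterate_succ_apply',
      dbar_comp_sliceHom, ih]

lemma dbarC_eqOn {D : Set ℂ} (hD : IsOpen D) (I : ℍ[ℝ]) {φ ψ : ℂ → ℍ[ℝ]} (h : Set.EqOn φ ψ D) :
    Set.EqOn (dbarC I φ) (dbarC I ψ) D := by
  intro z hz
  have he : φ =ᶠ[nhds z] ψ := h.eventuallyEq_of_mem (hD.mem_nhds hz)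
  simp only [dbarC, he.lineDeriv_eq]

lemma dbarC_iterate_eqOn {D : Set ℂ} (hD : IsOpen D) (I : ℍ[ℝ]) {φ ψ : ℂ → ℍ[ℝ]}
    (h : Set.EqOn φ ψ D) (m : ℕ) : Set.EqOn ((dbarC I)^[m] φ) ((dbarC I)^[m] ψ) D := by
  induction m with
  | zero => exact h
  | succ m ih =>
    rw [Function.iterate_succ_apply', Function.iterate_succ_apply']
    exact dbarC_eqOn hD I ih

lemma contDiffOn_dbarC {D : Set ℂ} (hD : IsOpen D) (I : ℍ[ℝ]) {φ : ℂ → ℍ[ℝ]} {m : ℕ}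
    (h : ContDiffOn ℝ (m + 1 : ℕ) φ D) : ContDiffOn ℝ m (dbarC I φ) D := by
  have h1 : ContDiffOn ℝ m (fderiv ℝ φ) D := h.fderiv_of_isOpen hD (by norm_cast)
  have h2 : ContDiffOn ℝ m
      (fun z => (1 / 2 : ℝ) • (fderiv ℝ φ z 1 + I * fderiv ℝ φ z Complex.I)) D :=
    ((h1.clm_apply contDiffOn_const).add
      (contDiffOn_const.mul (h1.clm_apply contDiffOn_const))).const_smul _
  refine h2.congr fun z hz => ?_
  have hd : DifferentiableAt ℝ φ z :=
    (h.differentiableOn (by norm_num)).differentiableAt (hD.mem_nhds hz)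
  simp only [dbarC, hd.lineDeriv_eq_fderiv]

lemma dbarC_add {I : ℍ[ℝ]} {φ ψ : ℂ → ℍ[ℝ]} {z : ℂ} (hφ : DifferentiableAt ℝ φ z)
    (hψ : DifferentiableAt ℝ ψ z) :
    dbarC I (fun w => φ w + ψ w) z = dbarC I φ z + dbarC I ψ z := by
  have h : ∀ v, lineDeriv ℝ (fun w => φ w + ψ w) z v = lineDeriv ℝ φ z v + lineDeriv ℝ ψ z v :=
    fun v => ((hφ.hasFDerivAt.add hψ.hasFDerivAt).hasLineDerivAt v).lineDeriv.trans (by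
      simp [hφ.lineDeriv_eq_fderiv, hψ.lineDeriv_eq_fderiv])
  simp only [dbarC, h, mul_add, smul_add]
  abel

lemma dbarC_iterate_add {D : Set ℂ} (hD : IsOpen D) (I : ℍ[ℝ]) (m : ℕ) {φ ψ : ℂ → ℍ[ℝ]}
    (hφ : ContDiffOn ℝ m φ D) (hψ : ContDiffOn ℝ m ψ D) :
    Set.EqOn ((dbarC I)^[m] fun w => φ w + ψ w)
      (fun w => (dbarC I)^[m] φ w + (dbarC I)^[m] ψ w) D := by
  induction m generalizing φ ψ with
  | zero => intro z _; rfl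
  | succ m ih =>
    simp only [Function.iterate_succ_apply]
    have h1 : Set.EqOn (dbarC I fun w => φ w + ψ w) (fun w => dbarC I φ w + dbarC I ψ w) D :=
      fun z hz => dbarC_add
        ((hφ.differentiableOn (by norm_num)).differentiableAt (hD.mem_nhds hz))
        ((hψ.differentiableOn (by norm_num)).differentiableAt (hD.mem_nhds hz))
    exact (dbarC_iterate_eqOn hD I h1 m).trans
      (ih (contDiffOn_dbarC hD I hφ) (contDiffOn_dbarC hD I hψ))

lemma dbarC_zero (I : ℍ[ℝ]) : dbarC I (fun _ => 0) = fun _ => 0 := by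
  ext1 z
  simp [dbarC, lineDeriv]

lemma dbarC_iterate_zero (I : ℍ[ℝ]) (m : ℕ) : (dbarC I)^[m] (fun _ => 0) = fun _ => 0 :=
  Function.iterate_fixed (dbarC_zero I) m

lemma dbarC_iterate_sum {D : Set ℂ} (hD : IsOpen D) (I : ℍ[ℝ]) (m : ℕ) (s : Finset ℕ)
    {φ : ℕ → ℂ → ℍ[ℝ]} (hφ : ∀ k ∈ s, ContDiffOn ℝ m (φ k) D) :
    Set.EqOn ((dbarC I)^[m] fun w => ∑ k ∈ s, φ k w)
      (fun w => ∑ k ∈ s, (dbarC I)^[m] (φ k) w) D := by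
  induction s using Finset.induction_on with
  | empty => intro z _; simp [dbarC_iterate_zero]
  | insert a s ha ih =>
    simp only [Finset.sum_insert ha]
    have h1 : ∀ k ∈ s, ContDiffOn ℝ m (φ k) D := fun k hk => hφ k (Finset.mem_insert_of_mem hk)
    refine (dbarC_iterate_add hD I m (hφ a (Finset.mem_insert_self _ _))
      (ContDiffOn.sum h1)).trans fun z hz => ?_
    simp only [ih h1 hz]

lemma contDiff_sliceHom {I : ℍ[ℝ]} (hI : I ∈ imagUnits) {n : WithTop ℕ∞} :
    ContDiff ℝ n (sliceHom I hI) :=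
  (sliceHom I hI).toLinearMap.toContinuousLinearMap.contDiff

lemma contDiff_sliceHom_conj_pow {I : ℍ[ℝ]} (hI : I ∈ imagUnits) (k : ℕ) {n : WithTop ℕ∞} :
    ContDiff ℝ n fun z : ℂ => sliceHom I hI (conj z) ^ k :=
  ((contDiff_sliceHom hI).comp Complex.conjCLE.contDiff).pow k

lemma hasLineDerivAt_sliceHom_conj_pow {I : ℍ[ℝ]} (hI : I ∈ imagUnits) (k : ℕ) (z v : ℂ) :
    HasLineDerivAt ℝ (fun w : ℂ => sliceHom I hI (conj w) ^ k)
      ((k : ℝ) • (sliceHom I hI (conj z) ^ (k - 1) * sliceHom I hI (conj v))) z v := by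
  have h1 : HasDerivAt (fun t : ℝ => conj (z + t • v)) (conj v) 0 := by
    have : HasDerivAt (fun t : ℝ => z + t • v) v 0 := by
      simpa using ((hasDerivAt_id (0 : ℝ)).smul_const v).const_add z
    exact (Complex.conjCLE : ℂ →L[ℝ] ℂ).hasFDerivAt.comp_hasDerivAt 0 this
  have h2 := h1.pow k
  have h3 := ((sliceHom I hI).toLinearMap.toContinuousLinearMap).hasFDerivAt.comp_hasDerivAt 0 h2
  have h4 : HasDerivAt (fun t : ℝ => sliceHom I hI (conj (z + t • v)) ^ k)
      (sliceHom I hI (k * conj (z + (0 : ℝ) • v) ^ (k - 1) * conj v)) 0 := by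
    convert! h3 using 1
    ext1 t
    simp
  have e : sliceHom I hI (k * conj (z + (0 : ℝ) • v) ^ (k - 1) * conj v) =
      (k : ℝ) • (sliceHom I hI (conj z) ^ (k - 1) * sliceHom I hI (conj v)) := by
    rw [zero_smul, add_zero, mul_assoc, ← nsmul_eq_mul, map_nsmul, map_mul, map_pow,
      Nat.cast_smul_eq_nsmul]
  rw [e] at h4
  exact h4

/-- The operator acts on `conj z ^ k ψ` as a derivation in `conj z`. -/
lemma dbarC_conj_pow_mul {I : ℍ[ℝ]} (hI : I ∈ imagUnits) (k : ℕ) {ψ : ℂ → ℍ[ℝ]} {z : ℂ}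
    (hψ : DifferentiableAt ℝ ψ z) (h0 : dbarC I ψ z = 0) (r : ℝ) :
    dbarC I (fun w => r • (sliceHom I hI (conj w) ^ k * ψ w)) z =
      (r * k) • (sliceHom I hI (conj z) ^ (k - 1) * ψ z) := by
  have h : ∀ v, lineDeriv ℝ (fun w => r • (sliceHom I hI (conj w) ^ k * ψ w)) z v =
      r • ((k : ℝ) • (sliceHom I hI (conj z) ^ (k - 1) * sliceHom I hI (conj v)) * ψ z +
        sliceHom I hI (conj z) ^ k * lineDeriv ℝ ψ z v) := fun v => by
    have h1 := (hasLineDerivAt_sliceHom_conj_pow hI k z v)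
    have h2 : HasLineDerivAt ℝ ψ (lineDeriv ℝ ψ z v) z v :=
      hψ.lineDifferentiableAt.hasLineDerivAt
    have h3 := (HasDerivAt.mul h1 h2).const_smul r
    simp only [zero_smul, add_zero] at h3
    exact HasLineDerivAt.lineDeriv h3
  have hcomm : ∀ w : ℂ, I * sliceHom I hI w = sliceHom I hI w * I := fun w => by
    have h1 : sliceHom I hI Complex.I * sliceHom I hI w =
        sliceHom I hI w * sliceHom I hI Complex.I := by
      rw [← map_mul, mul_comm, map_mul]
    rwa [sliceHom_I] at h1
  have h0' : lineDeriv ℝ ψ z 1 + I * lineDeriv ℝ ψ z Complex.I = 0 :=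
    (smul_eq_zero.1 h0).resolve_left (by norm_num)
  have e1 : I * (sliceHom I hI (conj z) ^ k * lineDeriv ℝ ψ z Complex.I) =
      sliceHom I hI (conj z) ^ k * (I * lineDeriv ℝ ψ z Complex.I) := by
    rw [← map_pow, ← mul_assoc, hcomm, mul_assoc]
  have e2 : I * (sliceHom I hI (conj z) ^ (k - 1) * -I * ψ z) =
      sliceHom I hI (conj z) ^ (k - 1) * ψ z := by
    rw [← map_pow, ← mul_assoc, ← mul_assoc, hcomm, mul_assoc _ I, mul_neg,
      mul_self_of_mem_imagUnits hI, neg_neg, mul_one]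
  have e3 : sliceHom I hI (conj z) ^ k * lineDeriv ℝ ψ z 1 =
      - (sliceHom I hI (conj z) ^ k * (I * lineDeriv ℝ ψ z Complex.I)) := by
    rw [eq_neg_of_add_eq_zero_left h0', mul_neg]
  simp only [dbarC, h, map_one, Complex.conj_I, map_neg, sliceHom_I, mul_one]
  rw [mul_smul_comm, mul_add, smul_mul_assoc, smul_mul_assoc, mul_smul_comm, e1, e2, e3]
  module

/-- Iterating the derivation; the right hand side vanishes as soon as `k < m`, where the truncated
exponent `k - m` is harmless. -/
lemma dbarC_iterate_conj_pow_mul {D : Set ℂ} (hD : IsOpen D) {I : ℍ[ℝ]} (hI : I ∈ imagUnits)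
    (k : ℕ) {ψ : ℂ → ℍ[ℝ]} (hψ : DifferentiableOn ℝ ψ D) (h0 : ∀ z ∈ D, dbarC I ψ z = 0) (m : ℕ) :
    Set.EqOn ((dbarC I)^[m] fun w => sliceHom I hI (conj w) ^ k * ψ w)
      (fun w => (k.descFactorial m : ℝ) • (sliceHom I hI (conj w) ^ (k - m) * ψ w)) D := by
  induction m with
  | zero => intro z _; simp
  | succ m ih =>
    rw [Function.iterate_succ_apply']
    refine (dbarC_eqOn hD I ih).trans fun z hz => ?_
    simp only [dbarC_conj_pow_mul hI (k - m) (hψ.differentiableAt (hD.mem_nhds hz)) (h0 z hz)]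
    rw [Nat.descFactorial_succ, Nat.sub_sub]
    push_cast
    rw [mul_comm]

/-! ### Holomorphic functions on the slice -/

/-- The quaternions as a complex normed space, where `ℂ` acts by left multiplication through the
slice `ℝ + ℝ i`. -/
@[reducible] noncomputable def leftNormedSpace : NormedSpace ℂ ℍ[ℝ] :=
  { Module.compHom ℍ[ℝ] (sliceHom unitI unitI_mem).toRingHom with
    norm_smul_le := fun z q => by
      change ‖sliceHom unitI unitI_mem z * q‖ ≤ _
      rw [norm_mul, norm_sliceHom] }

attribute [local instance] leftNormedSpace

lemma complex_smul_def (z : ℂ) (q : ℍ[ℝ]) : z • q = sliceHom unitI unitI_mem z * q := rfl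

lemma leftIsScalarTower : IsScalarTower ℝ ℂ ℍ[ℝ] :=
  ⟨fun r z q => by rw [complex_smul_def, complex_smul_def, map_smul, smul_mul_assoc]⟩

attribute [local instance] leftIsScalarTower

lemma hasLineDerivAt_of_hasDerivAt {φ : ℂ → ℍ[ℝ]} {d : ℍ[ℝ]} {z : ℂ} (h : HasDerivAt φ d z)
    (v : ℂ) : HasLineDerivAt ℝ φ (v • d) z v := by
  simpa using (h.hasFDerivAt.restrictScalars ℝ).hasLineDerivAt v

lemma dbarC_eq_zero_of_differentiableAt {φ : ℂ → ℍ[ℝ]} {z : ℂ} (h : DifferentiableAt ℂ φ z) :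
    dbarC unitI φ z = 0 := by
  rw [dbarC, (hasLineDerivAt_of_hasDerivAt h.hasDerivAt _).lineDeriv,
    (hasLineDerivAt_of_hasDerivAt h.hasDerivAt _).lineDeriv, one_smul, complex_smul_def,
    sliceHom_I, unitI_mul_unitI_mul, add_neg_cancel, smul_zero]

lemma differentiableAt_of_dbarC_eq_zero {φ : ℂ → ℍ[ℝ]} {z : ℂ} (h : DifferentiableAt ℝ φ z)
    (h0 : dbarC unitI φ z = 0) : DifferentiableAt ℂ φ z := by
  have h1 : fderiv ℝ φ z 1 + unitI * fderiv ℝ φ z Complex.I = 0 := by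
    rw [dbarC, h.lineDeriv_eq_fderiv, h.lineDeriv_eq_fderiv] at h0
    exact (smul_eq_zero.1 h0).resolve_left (by norm_num)
  have h2 : fderiv ℝ φ z Complex.I = unitI * fderiv ℝ φ z 1 := by
    rw [eq_neg_of_add_eq_zero_left h1, mul_neg, unitI_mul_unitI_mul, neg_neg]
  refine (hasFDerivAt_of_restrictScalars ℝ (f' := ContinuousLinearMap.toSpanSingleton ℂ
    (fderiv ℝ φ z 1)) h.hasFDerivAt ?_).differentiableAt
  ext1 v
  have hv : v = v.re • (1 : ℂ) + v.im • Complex.I := by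
    simp [Complex.re_add_im]
  conv_rhs => rw [hv, map_add, map_smul, map_smul, h2]
  simp [complex_smul_def, sliceHom_apply, slicePoint, add_mul, Quaternion.coe_mul_eq_smul]

lemma contDiffOn_of_differentiableOn {D : Set ℂ} (hD : IsOpen D) {φ : ℂ → ℍ[ℝ]}
    (h : DifferentiableOn ℂ φ D) : ContDiffOn ℝ ∞ φ D :=
  (h.contDiffOn hD).restrict_scalars ℝ

lemma IsAxiallySymmetric.ball (r : ℝ) : IsAxiallySymmetric (Metric.ball 0 r) := by
  intro x y I hI J hJ h
  rw [mem_ball_zero_iff, ← sliceHom_mk hI, norm_sliceHom] at h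
  rwa [mem_ball_zero_iff, ← sliceHom_mk hJ, norm_sliceHom]

/-- Taylor coefficients at the origin. -/
noncomputable def taylorCoeff (φ : ℂ → ℍ[ℝ]) (j : ℕ) : ℍ[ℝ] :=
  ((j.factorial : ℂ)⁻¹) • iteratedDeriv j φ 0

lemma hasSum_taylorCoeff {φ : ℂ → ℍ[ℝ]} {r : ℝ} (h : DifferentiableOn ℂ φ (Metric.ball 0 r))
    {z : ℂ} (hz : ‖z‖ < r) :
    HasSum (fun j => sliceHom unitI unitI_mem z ^ j * taylorCoeff φ j) (φ z) := by
  have := Complex.hasSum_taylorSeries_on_ball h (mem_ball_zero_iff.2 hz)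
  convert! this using 1
  ext1 j
  rw [sub_zero, smul_comm, taylorCoeff, complex_smul_def (z ^ j), map_pow]

lemma summable_norm_taylorCoeff {φ : ℂ → ℍ[ℝ]} {r : ℝ}
    (h : DifferentiableOn ℂ φ (Metric.ball 0 r)) {ρ : ℝ} (hρ : 0 ≤ ρ) (hr : ρ < r) :
    Summable fun j => ‖taylorCoeff φ j‖ * ρ ^ j := by
  have hz : ‖(ρ : ℂ)‖ = ρ := by simp [abs_of_nonneg hρ]
  have := (hasSum_taylorCoeff h (z := ρ) (by rwa [hz])).summable.norm
  refine this.congr fun j => ?_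
  rw [norm_mul, norm_pow, norm_sliceHom, hz, mul_comm]

lemma sliceExt_eqOn_qSeries {φ : ℂ → ℍ[ℝ]} {r : ℝ}
    (h : DifferentiableOn ℂ φ (Metric.ball 0 r)) :
    Set.EqOn (qSeries (taylorCoeff φ)) (sliceExt φ) (Metric.ball 0 r) := by
  refine (isSliceFunction_qSeries fun q hq => summable_norm_taylorCoeff h (norm_nonneg q)
    (mem_ball_zero_iff.1 hq)).eqOn_sliceExt (.ball r) fun z hz => ?_
  have hz' : ‖z‖ < r := by
    have : sliceHom unitI unitI_mem z ∈ Metric.ball (0 : ℍ[ℝ]) r :=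
      ((IsAxiallySymmetric.ball r).sliceHom_mem_iff unitI_mem z).2 hz
    rwa [mem_ball_zero_iff, norm_sliceHom] at this
  exact (hasSum_taylorCoeff h hz').tsum_eq

/-! ### Regularity of the slice extension -/

lemma contDiffAt_sliceExt_of_im_ne_zero {φ : ℂ → ℍ[ℝ]} {q : ℍ[ℝ]} (hq : q.im ≠ 0)
    (h1 : ContDiffAt ℝ ∞ φ (sliceCoord q)) (h2 : ContDiffAt ℝ ∞ φ (conj (sliceCoord q))) :
    ContDiffAt ℝ ∞ (sliceExt φ) q := by
  have hre : ContDiff ℝ ∞ fun q : ℍ[ℝ] => q.re :=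
    (LinearMap.toContinuousLinearMap ({ toFun := fun q => q.re
                                        map_add' := fun _ _ => rfl
                                        map_smul' := fun _ _ => rfl } : ℍ[ℝ] →ₗ[ℝ] ℝ)).contDiff
  have him : ContDiff ℝ ∞ fun q : ℍ[ℝ] => q.im := by
    have : (fun q : ℍ[ℝ] => q.im) = fun q => q - q.re • (1 : ℍ[ℝ]) := by
      ext1 q
      rw [← Quaternion.coe_mul_eq_smul, mul_one, Quaternion.sub_re_self]
    rw [this]
    exact contDiff_id.sub (hre.smul contDiff_const)
  have hn : ContDiffAt ℝ ∞ (fun q : ℍ[ℝ] => ‖q.im‖) q := him.contDiffAt.norm ℝ hq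
  have hc : ContDiffAt ℝ ∞ sliceCoord q := by
    have : sliceCoord = fun q => Complex.equivRealProdCLM.symm (q.re, ‖q.im‖) := by
      ext1 q; apply Complex.ext <;> simp [sliceCoord]
    rw [this]
    exact Complex.equivRealProdCLM.symm.contDiff.contDiffAt.comp q (hre.contDiffAt.prodMk hn)
  have hd : ContDiffAt ℝ ∞ imDir q :=
    (hn.inv (norm_ne_zero_iff.2 hq)).smul him.contDiffAt
  have f1 : ContDiffAt ℝ ∞ (fun q => φ (sliceCoord q)) q := h1.comp q hc
  have f2 : ContDiffAt ℝ ∞ (fun q => φ (conj (sliceCoord q))) q :=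
    h2.comp q (Complex.conjCLE.contDiff.contDiffAt.comp q hc)
  exact ((f1.add f2).const_smul _).sub
    ((hd.mul (contDiffAt_const.mul (f1.sub f2))).const_smul _)

/-- The slice extension commutes with real translations. -/
lemma sliceExt_comp_add (φ : ℂ → ℍ[ℝ]) (x : ℝ) (q : ℍ[ℝ]) :
    sliceExt (fun z => φ (z + x)) q = sliceExt φ (q + (x : ℍ[ℝ])) := by
  have h1 : (q + (x : ℍ[ℝ])).im = q.im := by simp
  have h2 : sliceCoord (q + (x : ℍ[ℝ])) = sliceCoord q + x := by
    apply Complex.ext <;> simp [sliceCoord]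
  simp only [sliceExt, imDir, h1, h2, map_add, Complex.conj_ofReal]

/-- Near a real point the slice extension is a convergent power series, hence smooth. -/
lemma contDiffAt_sliceExt_real {D : Set ℂ} (hD : IsOpen D) {φ : ℂ → ℍ[ℝ]}
    (h : DifferentiableOn ℂ φ D) {x : ℝ} (hx : (x : ℂ) ∈ D) :
    ContDiffAt ℝ ∞ (sliceExt φ) (x : ℍ[ℝ]) := by
  obtain ⟨r, hr, hball⟩ := Metric.isOpen_iff.1 hD _ hx
  have hψ : DifferentiableOn ℂ (fun z => φ (z + x)) (Metric.ball 0 r) := by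
    refine h.comp (by fun_prop) fun z hz => hball ?_
    simpa [mem_ball_iff_norm] using hz
  have he := sliceExt_eqOn_qSeries hψ
  have hr2 : (0 : ℝ) < r / 2 := by positivity
  have han : ContDiffAt ℝ ∞ (qSeries (taylorCoeff fun z => φ (z + x))) ((x : ℍ[ℝ]) - x) := by
    rw [sub_self]
    exact (analyticOnNhd_qSeries (summable_norm_taylorCoeff hψ hr2.le (half_lt_self hr)) 0
      (Metric.mem_ball_self hr2)).contDiffAt
  have hcomp : ContDiffAt ℝ ∞
      (fun q : ℍ[ℝ] => qSeries (taylorCoeff fun z => φ (z + x)) (q - x)) (x : ℍ[ℝ]) :=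
    han.comp (f := fun q : ℍ[ℝ] => q - (x : ℍ[ℝ])) (x : ℍ[ℝ]) (contDiffAt_id.sub contDiffAt_const)
  refine hcomp.congr_of_eventuallyEq ?_
  filter_upwards [Metric.ball_mem_nhds (x : ℍ[ℝ]) hr] with q hq
  rw [he (show q - x ∈ Metric.ball (0 : ℍ[ℝ]) r by
    rw [mem_ball_zero_iff]; exact mem_ball_iff_norm.1 hq),
    sliceExt_comp_add, sub_add_cancel]

theorem contDiffOn_sliceExt {Ω : Set ℍ[ℝ]} (hΩ : IsOpen Ω) (hsym : IsAxiallySymmetric Ω)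
    {φ : ℂ → ℍ[ℝ]} (h : DifferentiableOn ℂ φ (sliceTrace Ω)) :
    ContDiffOn ℝ ∞ (sliceExt φ) Ω := by
  intro q hq
  refine ContDiffAt.contDiffWithinAt ?_
  have hD := isOpen_sliceTrace hΩ
  by_cases him : q.im = 0
  · have hqx : q = (q.re : ℍ[ℝ]) := by
      conv_lhs => rw [← Quaternion.re_add_im q, him, add_zero]
    rw [hqx]
    refine contDiffAt_sliceExt_real hD h ?_
    rw [← hsym.sliceHom_mem_iff unitI_mem, sliceHom_ofReal, ← hqx]
    exact hq
  · have hz : sliceCoord q ∈ sliceTrace Ω := by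
      obtain ⟨I, hI, x, y, rfl⟩ := exists_slicePoint q
      have hz := (hsym.slicePoint_mem_iff hI x y).1 hq
      rw [sliceCoord, re_slicePoint hI, im_slicePoint hI, norm_smul, norm_of_mem_imagUnits hI,
        mul_one, Real.norm_eq_abs]
      rcases abs_choice y with hy | hy <;> rw [hy]
      · exact hz
      · exact hsym.conj_mem hz
    have hs := contDiffOn_of_differentiableOn hD h
    exact contDiffAt_sliceExt_of_im_ne_zero him (hs.contDiffAt (hD.mem_nhds hz))
      (hs.contDiffAt (hD.mem_nhds (hsym.conj_mem hz)))

/-- The Cauchy-Riemann equation on one slice propagates to all slices. -/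
lemma dbar_sliceExt {φ : ℂ → ℍ[ℝ]} {z : ℂ} (h : DifferentiableAt ℂ φ z)
    (h' : DifferentiableAt ℂ φ (conj z)) {I : ℍ[ℝ]} (hI : I ∈ imagUnits) :
    dbar I (sliceExt φ) (sliceHom I hI z) = 0 := by
  have e0 : dbar I (sliceExt φ) (sliceHom I hI z) = dbarC I (sliceExt φ ∘ sliceHom I hI) z :=
    congrFun (dbar_comp_sliceHom hI _) z
  have e1 : sliceExt φ ∘ sliceHom I hI = fun w => (1 / 2 : ℝ) • (φ w + φ (conj w)) -
      (1 / 2 : ℝ) • (I * (unitI * (φ w - φ (conj w)))) := by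
    ext1 w; exact sliceExt_sliceHom φ hI w
  have hl : ∀ v, lineDeriv ℝ (sliceExt φ ∘ sliceHom I hI) z v =
      (1 / 2 : ℝ) • (v • deriv φ z + conj v • deriv φ (conj z)) -
      (1 / 2 : ℝ) • (I * (unitI * (v • deriv φ z - conj v • deriv φ (conj z)))) := fun v => by
    have a1 : HasDerivAt (fun t : ℝ => φ (z + t • v)) (v • deriv φ z) 0 :=
      hasLineDerivAt_of_hasDerivAt h.hasDerivAt v
    have a2 : HasDerivAt (fun t : ℝ => φ (conj (z + t • v))) (conj v • deriv φ (conj z)) 0 := by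
      have : HasDerivAt (fun t : ℝ => φ (conj z + t • conj v)) (conj v • deriv φ (conj z)) 0 :=
        hasLineDerivAt_of_hasDerivAt h'.hasDerivAt (conj v)
      convert! this using 2
      simp
    rw [e1]
    exact HasLineDerivAt.lineDeriv (((a1.add a2).const_smul (1 / 2 : ℝ)).sub
      ((((a1.sub a2).const_mul unitI).const_mul I).const_smul (1 / 2 : ℝ)))
  rw [e0, dbarC, hl, hl]
  simp only [map_one, one_smul, Complex.conj_I, neg_smul, complex_smul_def, sliceHom_I]
  rw [sub_neg_eq_add, mul_add unitI (unitI * _), unitI_mul_unitI_mul, unitI_mul_unitI_mul,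
    mul_sub I, mul_smul_comm, mul_smul_comm, mul_mul_of_mem_imagUnits hI, ← sub_eq_add_neg,
    ← mul_sub unitI]
  module

theorem isSliceRegular_sliceExt {Ω : Set ℍ[ℝ]} (hΩ : IsOpen Ω) (hsym : IsAxiallySymmetric Ω)
    {φ : ℂ → ℍ[ℝ]} (h : DifferentiableOn ℂ φ (sliceTrace Ω)) : IsSliceRegular Ω (sliceExt φ) where
  contDiffOn := (contDiffOn_sliceExt hΩ hsym h).of_le (by norm_cast)
  slice := isSliceFunction_sliceExt Ω φ
  dbar_eq_zero := by
    rintro I hI _ ⟨hq, x, y, rfl⟩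
    have hz : (⟨x, y⟩ : ℂ) ∈ sliceTrace Ω := (hsym.slicePoint_mem_iff hI x y).1 hq
    have hD := isOpen_sliceTrace hΩ
    rw [← sliceHom_mk hI]
    exact dbar_sliceExt (h.differentiableAt (hD.mem_nhds hz))
      (h.differentiableAt (hD.mem_nhds (hsym.conj_mem hz))) hI

/-! ### The polyanalytic decomposition -/

lemma exists_conj_pow_decomposition {D : Set ℂ} (hD : IsOpen D) (m : ℕ) {φ : ℂ → ℍ[ℝ]}
    (hφ : ContDiffOn ℝ m φ D) (h0 : ∀ z ∈ D, (dbarC unitI)^[m] φ z = 0) :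
    ∃ ψ : ℕ → ℂ → ℍ[ℝ], (∀ k, DifferentiableOn ℂ (ψ k) D) ∧
      ∀ z ∈ D, φ z = ∑ k ∈ Finset.range m, sliceHom unitI unitI_mem (conj z) ^ k * ψ k z := by
  induction m generalizing φ with
  | zero => exact ⟨fun _ _ => 0, fun _ => by fun_prop, fun z hz => by simpa using h0 z hz⟩
  | succ m ih =>
    -- the top coefficient is `(1 / m!)` times the `m`-th iterate
    set χ : ℂ → ℍ[ℝ] := (dbarC unitI)^[m] φ with hχ
    have hχ1 : ContDiffOn ℝ 1 χ D := by
      have : ∀ (l : ℕ) (φ : ℂ → ℍ[ℝ]), ContDiffOn ℝ (l + 1 : ℕ) φ D →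
          ContDiffOn ℝ 1 ((dbarC unitI)^[l] φ) D := by
        intro l
        induction l with
        | zero => intro φ h; simpa using h
        | succ l ihl => intro φ h; exact ihl _ (contDiffOn_dbarC hD unitI h)
      exact this m φ hφ
    have hχ0 : ∀ z ∈ D, dbarC unitI χ z = 0 := fun z hz => by
      have := h0 z hz
      rwa [Function.iterate_succ_apply'] at this
    have hχd : DifferentiableOn ℂ χ D := fun z hz =>
      (differentiableAt_of_dbarC_eq_zero
        ((hχ1.differentiableOn one_ne_zero).differentiableAt (hD.mem_nhds hz))
        (hχ0 z hz)).differentiableWithinAt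
    set ξ : ℂ → ℍ[ℝ] := fun z => -((m.factorial : ℝ)⁻¹ • χ z) with hξ
    have hξd : DifferentiableOn ℂ ξ D := (hχd.const_smul ((m.factorial : ℝ)⁻¹)).neg
    have hξs := contDiffOn_of_differentiableOn hD hξd
    have hξ0 : ∀ z ∈ D, dbarC unitI ξ z = 0 := fun z hz =>
      dbarC_eq_zero_of_differentiableAt (hξd.differentiableAt (hD.mem_nhds hz))
    have hterm : ContDiffOn ℝ m
        (fun z => sliceHom unitI unitI_mem (conj z) ^ m * ξ z) D :=
      (contDiff_sliceHom_conj_pow unitI_mem m).contDiffOn.mul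
        (hξs.of_le (by exact_mod_cast le_top))
    have hφm : ContDiffOn ℝ m φ D := hφ.of_le (by norm_cast; omega)
    have hzero : ∀ z ∈ D, (dbarC unitI)^[m]
        (fun z => φ z + sliceHom unitI unitI_mem (conj z) ^ m * ξ z) z = 0 := fun z hz => by
      rw [dbarC_iterate_add hD unitI m hφm hterm hz]
      simp only
      rw [dbarC_iterate_conj_pow_mul hD unitI_mem m
        (hξs.differentiableOn (by simp)) hξ0 m hz, ← hχ]
      simp only [hξ, Nat.descFactorial_self, Nat.sub_self, pow_zero, one_mul, smul_neg, smul_smul]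
      rw [mul_inv_cancel₀ (by exact_mod_cast m.factorial_ne_zero), one_smul, add_neg_cancel]
    obtain ⟨ψ, hψ, hsum⟩ := ih (hφm.add hterm) hzero
    refine ⟨fun k => if k = m then fun z => -ξ z else ψ k, fun k => ?_, fun z hz => ?_⟩
    · by_cases hk : k = m
      · simpa [hk] using hξd.neg
      · simpa [hk] using hψ k
    · simp only
      rw [Finset.sum_range_succ, if_pos rfl, mul_neg, eq_add_neg_iff_add_eq, hsum z hz]
      refine Finset.sum_congr rfl fun k hk => ?_
      rw [if_neg (Finset.mem_range.1 hk).ne]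

lemma conj_pow_decomposition_unique {D : Set ℂ} (hD : IsOpen D) (m : ℕ) {ψ : ℕ → ℂ → ℍ[ℝ]}
    (hψ : ∀ k, DifferentiableOn ℂ (ψ k) D)
    (h0 : ∀ z ∈ D, ∑ k ∈ Finset.range m, sliceHom unitI unitI_mem (conj z) ^ k * ψ k z = 0) :
    ∀ k < m, ∀ z ∈ D, ψ k z = 0 := by
  induction m with
  | zero => intro k hk; omega
  | succ m ih =>
    have hs : ∀ k, ContDiffOn ℝ ∞ (ψ k) D := fun k => contDiffOn_of_differentiableOn hD (hψ k)
    have hterm : ∀ k ∈ Finset.range (m + 1), ContDiffOn ℝ m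
        (fun z => sliceHom unitI unitI_mem (conj z) ^ k * ψ k z) D := fun k _ =>
      (contDiff_sliceHom_conj_pow unitI_mem k).contDiffOn.mul
        ((hs k).of_le (by exact_mod_cast le_top))
    have htop : ∀ z ∈ D, ψ m z = 0 := fun z hz => by
      have e1 := dbarC_iterate_eqOn hD unitI (fun z hz => h0 z hz) m hz
      rw [dbarC_iterate_sum hD unitI m _ hterm hz, dbarC_iterate_zero] at e1
      have e2 : ∀ k, (dbarC unitI)^[m]
          (fun z => sliceHom unitI unitI_mem (conj z) ^ k * ψ k z) z =
          (k.descFactorial m : ℝ) • (sliceHom unitI unitI_mem (conj z) ^ (k - m) * ψ k z) :=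
        fun k => dbarC_iterate_conj_pow_mul hD unitI_mem k ((hs k).differentiableOn (by simp))
          (fun w hw => dbarC_eq_zero_of_differentiableAt
            ((hψ k).differentiableAt (hD.mem_nhds hw))) m hz
      simp only [e2] at e1
      rw [Finset.sum_range_succ, Finset.sum_eq_zero, zero_add, Nat.descFactorial_self,
        Nat.sub_self, pow_zero, one_mul] at e1
      · exact (smul_eq_zero.1 e1).resolve_left (by exact_mod_cast m.factorial_ne_zero)
      · intro k hk
        rw [Nat.descFactorial_of_lt (Finset.mem_range.1 hk), Nat.cast_zero, zero_smul]
    have hlow := ih fun z hz => by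
      have := h0 z hz
      rwa [Finset.sum_range_succ, htop z hz, mul_zero, add_zero] at this
    intro k hk z hz
    rcases Nat.lt_succ_iff_lt_or_eq.1 hk with h | rfl
    · exact hlow k h z hz
    · exact htop z hz

lemma contDiffOn_comp_sliceHom {Ω : Set ℍ[ℝ]} (hsym : IsAxiallySymmetric Ω) {I : ℍ[ℝ]}
    (hI : I ∈ imagUnits) {n : WithTop ℕ∞} {f : ℍ[ℝ] → ℍ[ℝ]} (hf : ContDiffOn ℝ n f Ω) :
    ContDiffOn ℝ n (f ∘ sliceHom I hI) (sliceTrace Ω) :=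
  hf.comp (contDiff_sliceHom hI).contDiffOn fun z hz => (hsym.sliceHom_mem_iff hI z).2 hz

lemma sliceHom_mem_slicePlane {I : ℍ[ℝ]} (hI : I ∈ imagUnits) (z : ℂ) :
    sliceHom I hI z ∈ slicePlane I := ⟨z.re, z.im, sliceHom_apply hI z⟩

lemma IsSliceRegular.dbarC_eq_zero {Ω : Set ℍ[ℝ]} (hsym : IsAxiallySymmetric Ω)
    {F : ℍ[ℝ] → ℍ[ℝ]} (hF : IsSliceRegular Ω F) {I : ℍ[ℝ]} (hI : I ∈ imagUnits) :
    ∀ z ∈ sliceTrace Ω, dbarC I (F ∘ sliceHom I hI) z = 0 := fun z hz => by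
  rw [← dbar_comp_sliceHom hI]
  exact hF.dbar_eq_zero I hI _ ⟨(hsym.sliceHom_mem_iff hI z).2 hz, sliceHom_mem_slicePlane hI z⟩

lemma IsSliceRegular.differentiableOn {Ω : Set ℍ[ℝ]} (hΩ : IsOpen Ω) (hsym : IsAxiallySymmetric Ω)
    {F : ℍ[ℝ] → ℍ[ℝ]} (hF : IsSliceRegular Ω F) :
    DifferentiableOn ℂ (F ∘ sliceHom unitI unitI_mem) (sliceTrace Ω) := fun z hz =>
  (differentiableAt_of_dbarC_eq_zero
    (((contDiffOn_comp_sliceHom hsym unitI_mem hF.contDiffOn).differentiableOn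
      one_ne_zero).differentiableAt ((isOpen_sliceTrace hΩ).mem_nhds hz))
    (hF.dbarC_eq_zero hsym unitI_mem z hz)).differentiableWithinAt

lemma IsSliceRegular.contDiffOn_infty {Ω : Set ℍ[ℝ]} (hΩ : IsOpen Ω)
    (hsym : IsAxiallySymmetric Ω) {F : ℍ[ℝ] → ℍ[ℝ]} (hF : IsSliceRegular Ω F) :
    ContDiffOn ℝ ∞ F Ω :=
  (contDiffOn_sliceExt hΩ hsym (hF.differentiableOn hΩ hsym)).congr
    (hF.slice.eqOn_sliceExt hsym fun _ _ => rfl)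

lemma IsSliceRegular.mono {Ω U : Set ℍ[ℝ]} {F : ℍ[ℝ] → ℍ[ℝ]} (hF : IsSliceRegular Ω F)
    (h : U ⊆ Ω) : IsSliceRegular U F :=
  ⟨hF.contDiffOn.mono h, hF.slice.mono h, fun I hI q hq => hF.dbar_eq_zero I hI q ⟨h hq.1, hq.2⟩⟩

lemma IsPolyDecomposition.mono {n : ℕ} {Ω U : Set ℍ[ℝ]} {g : ℍ[ℝ] → ℍ[ℝ]}
    {F : Fin (n + 1) → ℍ[ℝ] → ℍ[ℝ]} (hF : IsPolyDecomposition n Ω g F) (h : U ⊆ Ω) :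
    IsPolyDecomposition n U g F :=
  ⟨fun k => (hF.1 k).mono h, fun q hq => hF.2 q (h hq)⟩

theorem IsSlicePolyanalytic.exists_polyDecomposition {n : ℕ} {Ω : Set ℍ[ℝ]} (hΩ : IsOpen Ω)
    (hsym : IsAxiallySymmetric Ω) {g : ℍ[ℝ] → ℍ[ℝ]} (hg : IsSlicePolyanalytic (n + 1) Ω g) :
    ∃ F, IsPolyDecomposition n Ω g F := by
  have hD := isOpen_sliceTrace hΩ
  obtain ⟨ψ, hψ, hsum⟩ := exists_conj_pow_decomposition hD (n + 1)
    (contDiffOn_comp_sliceHom hsym unitI_mem hg.contDiffOn) fun z hz => by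
      rw [← dbar_iterate_comp_sliceHom unitI_mem]
      exact hg.dbar_eq_zero unitI unitI_mem _
        ⟨(hsym.sliceHom_mem_iff unitI_mem z).2 hz, sliceHom_mem_slicePlane unitI_mem z⟩
  refine ⟨fun k => sliceExt (ψ k), fun k => isSliceRegular_sliceExt hΩ hsym (hψ k), ?_⟩
  refine hg.slice.eqOn hsym (isSliceFunction_sum _ fun k =>
    (isSliceFunction_sliceExt Ω (ψ k)).star_pow_mul k) fun z hz => ?_
  have h := hsum z hz
  rw [Finset.sum_range] at h
  simp only [sliceExt_unitI, star_sliceHom]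
  exact h

theorem IsPolyDecomposition.unique {n : ℕ} {Ω : Set ℍ[ℝ]} (hΩ : IsOpen Ω)
    (hsym : IsAxiallySymmetric Ω) {g : ℍ[ℝ] → ℍ[ℝ]} {F G : Fin (n + 1) → ℍ[ℝ] → ℍ[ℝ]}
    (hF : IsPolyDecomposition n Ω g F) (hG : IsPolyDecomposition n Ω g G) (k : Fin (n + 1)) :
    Set.EqOn (F k) (G k) Ω := by
  have hD := isOpen_sliceTrace hΩ
  let ψ : ℕ → ℂ → ℍ[ℝ] := fun k => if h : k < n + 1 then
    fun z => F ⟨k, h⟩ (sliceHom unitI unitI_mem z) - G ⟨k, h⟩ (sliceHom unitI unitI_mem z) else 0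
  have hψk : ∀ k : Fin (n + 1), ψ k = fun z =>
      F k (sliceHom unitI unitI_mem z) - G k (sliceHom unitI unitI_mem z) := fun k => by
    simp only [ψ, k.2, dite_true, Fin.eta]
  have hψ : ∀ k, DifferentiableOn ℂ (ψ k) (sliceTrace Ω) := fun k => by
    by_cases h : k < n + 1
    · rw [hψk ⟨k, h⟩]
      exact ((hF.1 _).differentiableOn hΩ hsym).sub ((hG.1 _).differentiableOn hΩ hsym)
    · simp only [ψ, h, dite_false]
      exact differentiableOn_const 0
  refine (hF.1 k).slice.eqOn hsym (hG.1 k).slice fun z hz => ?_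
  refine sub_eq_zero.1 ?_
  have := conj_pow_decomposition_unique hD (n + 1) hψ (fun z hz => ?_) k k.2 z hz
  · rwa [hψk] at this
  · have hq := (hsym.sliceHom_mem_iff unitI_mem z).2 hz
    have e := (hF.2 _ hq).symm.trans (hG.2 _ hq)
    rw [Finset.sum_range]
    simp only [hψk, mul_sub, Finset.sum_sub_distrib, ← star_sliceHom]
    exact sub_eq_zero.2 e

theorem IsPolyDecomposition.isSlicePolyanalytic {n : ℕ} {Ω : Set ℍ[ℝ]} (hΩ : IsOpen Ω)
    (hsym : IsAxiallySymmetric Ω) {g : ℍ[ℝ] → ℍ[ℝ]} {F : Fin (n + 1) → ℍ[ℝ] → ℍ[ℝ]}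
    (hF : IsPolyDecomposition n Ω g F) : IsSlicePolyanalytic (n + 1) Ω g where
  contDiffOn := by
    have hstar : ContDiff ℝ ∞ fun q : ℍ[ℝ] => star q :=
      (LinearMap.toContinuousLinearMap ({ toFun := star
                                          map_add' := star_add
                                          map_smul' := fun r q => Quaternion.star_smul r q } :
        ℍ[ℝ] →ₗ[ℝ] ℍ[ℝ])).contDiff
    have hs : ContDiffOn ℝ ∞ (fun q => ∑ k : Fin (n + 1), star q ^ (k : ℕ) * F k q) Ω :=
      ContDiffOn.sum fun k _ =>
        (hstar.pow k).contDiffOn.mul ((hF.1 k).contDiffOn_infty hΩ hsym)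
    exact (hs.congr hF.2).of_le (by exact_mod_cast le_top)
  slice := (isSliceFunction_sum _ fun k => (hF.1 k).slice.star_pow_mul k).congr hF.2
  dbar_eq_zero := by
    rintro I hI _ ⟨hq, x, y, rfl⟩
    have hD := isOpen_sliceTrace hΩ
    rw [← sliceHom_mk hI] at hq ⊢
    have hz := (hsym.sliceHom_mem_iff hI _).1 hq
    generalize (⟨x, y⟩ : ℂ) = z at hz
    let ψ : ℕ → ℂ → ℍ[ℝ] := fun k => if h : k < n + 1 then F ⟨k, h⟩ ∘ sliceHom I hI else 0
    have hψk : ∀ k : Fin (n + 1), ψ k = F k ∘ sliceHom I hI := fun k => by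
      simp only [ψ, k.2, dite_true, Fin.eta]
    have hψ : ∀ k ∈ Finset.range (n + 1), ContDiffOn ℝ ∞ (ψ k) (sliceTrace Ω) ∧
        ∀ z ∈ sliceTrace Ω, dbarC I (ψ k) z = 0 := fun k hk => by
      rw [hψk ⟨k, Finset.mem_range.1 hk⟩]
      exact ⟨contDiffOn_comp_sliceHom hsym hI ((hF.1 _).contDiffOn_infty hΩ hsym),
        (hF.1 _).dbarC_eq_zero hsym hI⟩
    have hsum : Set.EqOn (g ∘ sliceHom I hI)
        (fun z => ∑ k ∈ Finset.range (n + 1), sliceHom I hI (conj z) ^ k * ψ k z)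
        (sliceTrace Ω) := fun z hz => by
      simp only [Finset.sum_range, hψk, ← star_sliceHom]
      exact hF.2 _ ((hsym.sliceHom_mem_iff hI z).2 hz)
    have e : (dbar I)^[n + 1] g (sliceHom I hI z) = (dbarC I)^[n + 1] (g ∘ sliceHom I hI) z :=
      congrFun (dbar_iterate_comp_sliceHom hI g (n + 1)) z
    rw [e, dbarC_iterate_eqOn hD I hsum (n + 1) hz, dbarC_iterate_sum hD I (n + 1) _
      (fun k hk => (contDiff_sliceHom_conj_pow hI k).contDiffOn.mul
        ((hψ k hk).1.of_le (by exact_mod_cast le_top))) hz]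
    refine Finset.sum_eq_zero fun k hk => ?_
    rw [dbarC_iterate_conj_pow_mul hD hI k ((hψ k hk).1.differentiableOn (by simp)) (hψ k hk).2
      (n + 1) hz]
    simp only
    rw [Nat.descFactorial_of_lt (Finset.mem_range.1 hk), Nat.cast_zero, zero_smul]

/-! ### Convergence of the expansions -/

/-- An open set contains, with each point, a point of larger norm which is neither real nor purely
imaginary. -/
lemma exists_mem_norm_lt {U : Set ℍ[ℝ]} (hU : IsOpen U) {q : ℍ[ℝ]} (hq : q ∈ U) :
    ∃ p ∈ U, ‖q‖ < ‖p‖ ∧ p.re ≠ 0 ∧ p.im ≠ 0 := by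
  -- both the real part and the first imaginary component are moved away from `0`
  obtain ⟨a, ha, ha'⟩ : ∃ a : ℝ, |a| = 1 ∧ a * q.re = |q.re| := by
    rcases abs_choice q.re with h | h
    · exact ⟨1, by simp, by simp [h]⟩
    · exact ⟨-1, by simp, by simp [h]⟩
  obtain ⟨b, hb, hb'⟩ : ∃ b : ℝ, |b| = 1 ∧ b * q.imI = |q.imI| := by
    rcases abs_choice q.imI with h | h
    · exact ⟨1, by simp, by simp [h]⟩
    · exact ⟨-1, by simp, by simp [h]⟩
  have ha2 : a * a = 1 := by rw [← abs_mul_abs_self, ha, one_mul]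
  have hb2 : b * b = 1 := by rw [← abs_mul_abs_self, hb, one_mul]
  let d : ℍ[ℝ] := a • 1 + b • unitI
  have hcont : Filter.Tendsto (fun t : ℝ => q + t • d) (nhdsWithin 0 (Set.Ioi 0)) (nhds q) := by
    have : Continuous fun t : ℝ => q + t • d := by fun_prop
    have h := this.tendsto 0
    rw [zero_smul, add_zero] at h
    exact h.mono_left nhdsWithin_le_nhds
  obtain ⟨t, htU, ht⟩ :=
    ((hcont.eventually (hU.mem_nhds hq)).and self_mem_nhdsWithin : ∀ᶠ t in nhdsWithin (0 : ℝ) (Set.Ioi 0),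
      q + t • d ∈ U ∧ t ∈ Set.Ioi (0 : ℝ)).exists
  have ht : 0 < t := ht
  have c0 : (q + t • d).re = q.re + t * a := by simp [d, unitI]
  have c1 : (q + t • d).imI = q.imI + t * b := by simp [d, unitI]
  have c2 : (q + t • d).imJ = q.imJ := by simp [d, unitI]
  have c3 : (q + t • d).imK = q.imK := by simp [d, unitI]
  have hre : a * (q + t • d).re = |q.re| + t := by rw [c0, mul_add, ha', mul_left_comm, ha2, mul_one]
  have him : b * (q + t • d).imI = |q.imI| + t := by
    rw [c1, mul_add, hb', mul_left_comm, hb2, mul_one]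
  refine ⟨q + t • d, htU, ?_, fun h => ?_, fun h => ?_⟩
  · refine lt_of_pow_lt_pow_left₀ 2 (norm_nonneg _) ?_
    rw [sq, sq, ← Quaternion.normSq_eq_norm_mul_self, ← Quaternion.normSq_eq_norm_mul_self,
      Quaternion.normSq_def', Quaternion.normSq_def', c0, c1, c2, c3]
    have h1 : (q.re + t * a) ^ 2 = q.re ^ 2 + 2 * t * |q.re| + t ^ 2 := by
      rw [← ha']; linear_combination t ^ 2 * ha2
    have h2 : (q.imI + t * b) ^ 2 = q.imI ^ 2 + 2 * t * |q.imI| + t ^ 2 := by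
      rw [← hb']; linear_combination t ^ 2 * hb2
    rw [h1, h2]
    have := mul_nonneg ht.le (abs_nonneg q.re)
    have := mul_nonneg ht.le (abs_nonneg q.imI)
    have := pow_pos ht 2
    linarith
  · rw [h, mul_zero] at hre
    linarith [abs_nonneg q.re]
  · have : (q + t • d).imI = 0 := by
      rw [← Quaternion.imI_im, h]; rfl
    rw [this, mul_zero] at him
    linarith [abs_nonneg q.imI]

/-- Closed form of the polynomials `∑ (s - j + 1) x ^ (s - j) y ^ j`. -/
lemma sq_sub_mul_sum {R : Type*} [CommRing R] (x y : R) (s : ℕ) :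
    (x - y) ^ 2 * ∑ j ∈ Finset.range (s + 1), ((s : R) - j + 1) * (x ^ (s - j) * y ^ j) =
      (s + 1) * x ^ (s + 2) - (s + 2) * (x ^ (s + 1) * y) + y ^ (s + 2) := by
  induction s with
  | zero => simp; ring
  | succ s ih =>
    have h1 : ∑ j ∈ Finset.range (s + 2), (((s + 1 : ℕ) : R) - j + 1) * (x ^ (s + 1 - j) * y ^ j) =
        x * ∑ j ∈ Finset.range (s + 1), ((s : R) - j + 1) * (x ^ (s - j) * y ^ j) +
          ∑ j ∈ Finset.range (s + 2), y ^ j * x ^ (s + 1 - j) := by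
      rw [Finset.sum_range_succ, Finset.sum_range_succ _ (s + 1), Finset.mul_sum, ← add_assoc,
        ← Finset.sum_add_distrib]
      congr 1
      · refine Finset.sum_congr rfl fun j hj => ?_
        have : s + 1 - j = (s - j) + 1 := by have := Finset.mem_range.1 hj; omega
        rw [this, pow_succ]
        push_cast; ring
      · push_cast; simp
    have h2 : (x - y) * ∑ j ∈ Finset.range (s + 2), y ^ j * x ^ (s + 1 - j) =
        x ^ (s + 2) - y ^ (s + 2) := by
      have := geom_sum₂_mul y x (s + 2)
      simp only [show ∀ j, s + 2 - 1 - j = s + 1 - j from fun j => by omega] at this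
      linear_combination -this
    rw [h1]
    push_cast
    linear_combination x * ih + (x - y) * h2

/-- The leading terms `(s + 1) z ^ (s + 2) - (s + 2) z ^ (s + 1) conj z` of the closed form dominate,
as they grow like `s ‖z - conj z‖ ‖z‖ ^ (s + 1)`. -/
lemma norm_sum_ge {z : ℂ} (hz : z.im ≠ 0) : ∀ᶠ s : ℕ in Filter.atTop, ‖z‖ ^ (s + 2) ≤
    ‖z - conj z‖ ^ 2 *
      ‖∑ j ∈ Finset.range (s + 1), ((s : ℂ) - j + 1) * (z ^ (s - j) * conj z ^ j)‖ := by
  have hpos : 0 < ‖z - conj z‖ := by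
    rw [norm_pos_iff, Complex.sub_conj]
    simp [hz]
  obtain ⟨N, hN⟩ := exists_nat_gt (3 * ‖z‖ / ‖z - conj z‖)
  filter_upwards [Filter.eventually_ge_atTop N] with s hs
  rw [← norm_pow, ← norm_pow, ← norm_mul, sq_sub_mul_sum]
  have h1 : 3 * ‖z‖ ≤ (s + 1) * ‖z - conj z‖ := by
    rw [div_lt_iff₀ hpos] at hN
    have : (N : ℝ) ≤ s + 1 := by exact_mod_cast hs.trans (Nat.le_succ s)
    exact hN.le.trans (by gcongr)
  have h2 : ‖((s : ℂ) + 1) * (z - conj z)‖ = (s + 1) * ‖z - conj z‖ := by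
    rw [norm_mul]
    congr 1
    have : ((s : ℂ) + 1) = ((s + 1 : ℕ) : ℂ) := by push_cast; rfl
    rw [this, Complex.norm_natCast]
    push_cast; rfl
  have h3 : ((s : ℂ) + 1) * z ^ (s + 2) - (s + 2) * (z ^ (s + 1) * conj z) + conj z ^ (s + 2) =
      z ^ (s + 1) * (((s : ℂ) + 1) * (z - conj z)) - z ^ (s + 1) * conj z + conj z ^ (s + 2) := by
    ring
  have h4 : ‖z ^ (s + 1) * (((s : ℂ) + 1) * (z - conj z))‖ ≤
      ‖z ^ (s + 1) * (((s : ℂ) + 1) * (z - conj z)) - z ^ (s + 1) * conj z + conj z ^ (s + 2)‖ +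
        ‖z ^ (s + 1) * conj z‖ + ‖conj z ^ (s + 2)‖ := by
    calc _ = ‖(z ^ (s + 1) * (((s : ℂ) + 1) * (z - conj z)) - z ^ (s + 1) * conj z +
          conj z ^ (s + 2)) + z ^ (s + 1) * conj z - conj z ^ (s + 2)‖ := by congr 1; ring
      _ ≤ _ := (norm_sub_le _ _).trans (by gcongr; exact norm_add_le _ _)
  rw [h3]
  rw [norm_mul, norm_mul (z ^ (s + 1)) (conj z), h2, norm_pow, norm_pow, Complex.norm_conj] at h4
  rw [norm_pow]
  have h5 : ‖z‖ ^ (s + 1) * (3 * ‖z‖) ≤ ‖z‖ ^ (s + 1) * ((s + 1) * ‖z - conj z‖) := by gcongr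
  have h6 : ‖z‖ ^ (s + 2) = ‖z‖ ^ (s + 1) * ‖z‖ := pow_succ _ _
  rw [h6] at h4 ⊢
  linarith

lemma appellQ_sliceHom {I : ℍ[ℝ]} (hI : I ∈ imagUnits) (z : ℂ) (s : ℕ) :
    (((s : ℝ) + 1) * ((s : ℝ) + 2)) • appellQ s (sliceHom I hI z) = (2 : ℝ) • sliceHom I hI
      (∑ j ∈ Finset.range (s + 1), ((s : ℂ) - j + 1) * (z ^ (s - j) * conj z ^ j)) := by
  rw [appellQ, map_sum, Finset.smul_sum, Finset.smul_sum]
  refine Finset.sum_congr rfl fun j _ => ?_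
  have : ((s : ℂ) - j + 1) * (z ^ (s - j) * conj z ^ j) =
      ((s : ℝ) - j + 1) • (z ^ (s - j) * conj z ^ j) := by
    rw [Complex.real_smul]; push_cast; rfl
  rw [this, map_smul, map_mul, map_pow, map_pow, star_sliceHom, smul_smul, smul_smul]
  congr 1
  field_simp

/-- Convergence of an Appell expansion on an open set forces convergence of the underlying power
series there. At a point which is neither real nor purely imaginary the norms of the Appell
polynomials are bounded below, up to a constant, by `‖q‖ ^ (s + 2) / ((s + 1) (s + 2))`; such
points of larger norm exist near every point. -/
lemma summable_of_summable_appellM {U : Set ℍ[ℝ]} (hU : IsOpen U) {k : ℕ} {c : ℕ → ℍ[ℝ]}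
    (h : ∀ q ∈ U, Summable fun s : ℕ =>
      appellM k s q * ((-2 * ((s : ℝ) + 1) * ((s : ℝ) + 2)) • c (s + 2))) :
    ∀ q ∈ U, Summable fun j => ‖c j‖ * ‖q‖ ^ j := by
  intro q hq
  obtain ⟨p, hpU, hqp, hre, him⟩ := exists_mem_norm_lt hU hq
  suffices hp : Summable fun j => ‖c j‖ * ‖p‖ ^ j by
    exact hp.of_nonneg_of_le (fun j => by positivity) fun j => by gcongr
  have hs := (h p hpU).norm
  obtain ⟨I, hI, x, y, rfl⟩ := exists_slicePoint p
  rw [re_slicePoint hI] at hre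
  rw [im_slicePoint hI] at him
  have hy : y ≠ 0 := fun h => him (by rw [h, zero_smul])
  set z : ℂ := ⟨x, y⟩ with hz
  set T : ℕ → ℂ := fun s =>
    ∑ j ∈ Finset.range (s + 1), ((s : ℂ) - j + 1) * (z ^ (s - j) * conj z ^ j) with hT
  have hnorm : ∀ s : ℕ, ‖appellM k s (slicePoint I x y) *
      ((-2 * ((s : ℝ) + 1) * ((s : ℝ) + 2)) • c (s + 2))‖ =
      |x| ^ k * (4 * ‖T s‖) * ‖c (s + 2)‖ := fun s => by
    have e : appellM k s (slicePoint I x y) *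
        ((-2 * ((s : ℝ) + 1) * ((s : ℝ) + 2)) • c (s + 2)) =
        (-4 * x ^ k) • (sliceHom I hI (T s) * c (s + 2)) := by
      have e1 := appellQ_sliceHom hI z s
      rw [appellM, re_slicePoint hI, ← sliceHom_mk hI, mul_smul_comm, smul_mul_assoc, smul_smul,
        show -2 * ((s : ℝ) + 1) * (s + 2) * x ^ k = (-2 * x ^ k) * ((s + 1) * (s + 2)) by ring,
        ← smul_smul, ← smul_mul_assoc ((s + 1 : ℝ) * (s + 2)), e1, smul_mul_assoc, smul_smul]
      congr 1
      ring
    rw [e, norm_smul, norm_mul, norm_mul, norm_sliceHom, norm_pow]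
    norm_num
    ring
  have hx : 0 < |x| ^ k := by positivity
  rw [← sliceHom_mk hI, norm_sliceHom, ← summable_nat_add_iff 2]
  refine summable_of_isBigO_nat hs (Asymptotics.IsBigO.of_bound
    (‖z - conj z‖ ^ 2 / (4 * |x| ^ k)) ?_)
  filter_upwards [norm_sum_ge (z := z) hy] with s hs
  rw [norm_norm, hnorm, norm_mul, norm_norm, norm_pow, norm_norm]
  calc ‖c (s + 2)‖ * ‖z‖ ^ (s + 2) ≤ ‖c (s + 2)‖ * (‖z - conj z‖ ^ 2 * ‖T s‖) := by gcongr
    _ = _ := by field_simp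

/-- Convergence with the factor `conj q ^ k`, which vanishes at the origin only, forces convergence
of the power series. -/
lemma summable_of_summable_conj_pow {U : Set ℍ[ℝ]} (hU : IsOpen U) {k : ℕ} {c : ℕ → ℍ[ℝ]}
    (h : ∀ q ∈ U, Summable fun j : ℕ => star q ^ k * q ^ j * c j) :
    ∀ q ∈ U, Summable fun j => ‖c j‖ * ‖q‖ ^ j := by
  intro q hq
  obtain ⟨p, hpU, hqp, -, -⟩ := exists_mem_norm_lt hU hq
  have hp0 : 0 < ‖p‖ := (norm_nonneg q).trans_lt hqp
  have hs := (h p hpU).norm.mul_left ((‖p‖ ^ k)⁻¹)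
  refine hs.of_nonneg_of_le (fun j => by positivity) fun j => ?_
  rw [norm_mul, norm_mul, norm_pow, norm_pow, Quaternion.norm_star, mul_assoc,
    inv_mul_cancel_left₀ (by positivity), mul_comm]
  gcongr

lemma summable_conj_pow {k : ℕ} {c : ℕ → ℍ[ℝ]} {q : ℍ[ℝ]}
    (h : Summable fun j => ‖c j‖ * ‖q‖ ^ j) : Summable fun j : ℕ => star q ^ k * q ^ j * c j := by
  simpa only [mul_assoc] using (summable_pow_mul h le_rfl).mul_left (star q ^ k)

lemma tsum_conj_pow (k : ℕ) (c : ℕ → ℍ[ℝ]) (q : ℍ[ℝ]) :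
    ∑' j : ℕ, star q ^ k * q ^ j * c j = star q ^ k * qSeries c q := by
  simp only [mul_assoc, qSeries, tsum_mul_left]

lemma powDeriv_of_commute {I q : ℍ[ℝ]} (h : I * q = q * I) (m : ℕ) :
    powDeriv I q m = I * powDeriv 1 q m := by
  induction m with
  | zero => simp [powDeriv]
  | succ m ih =>
    have hc : Commute I (q ^ m) := (show Commute I q from h).pow_right m
    rw [powDeriv, powDeriv, ih, mul_add, mul_one, hc.eq, mul_assoc]

lemma isSliceRegular_qSeries {U : Set ℍ[ℝ]} (hU : IsOpen U) {c : ℕ → ℍ[ℝ]}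
    (hc : ∀ q ∈ U, Summable fun j => ‖c j‖ * ‖q‖ ^ j) : IsSliceRegular U (qSeries c) where
  contDiffOn := fun q hq => by
    obtain ⟨p, hpU, hqp, -, -⟩ := exists_mem_norm_lt hU hq
    exact (analyticOnNhd_qSeries (hc p hpU) q
      (mem_ball_zero_iff.2 hqp)).contDiffAt.contDiffWithinAt
  slice := isSliceFunction_qSeries hc
  dbar_eq_zero := by
    rintro I hI _ ⟨hq, x, y, rfl⟩
    obtain ⟨p, hpU, hqp, -, -⟩ := exists_mem_norm_lt hU hq
    have hl : ∀ e, lineDeriv ℝ (qSeries c) (slicePoint I x y) e =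
        ∑' j, powDeriv e (slicePoint I x y) j * c j := fun e =>
      HasLineDerivAt.lineDeriv (hasDerivAt_qSeries_line (hc p hpU) hqp e).1
    -- `q` commutes with `I`, so the derivative along `I` is `I` times the derivative along `1`
    have hcomm : I * slicePoint I x y = slicePoint I x y * I := by
      rw [slicePoint, mul_add, add_mul, Quaternion.coe_commutes, smul_mul_assoc, mul_smul_comm]
    rw [dbar, hl, hl]
    simp only [powDeriv_of_commute hcomm, mul_assoc, tsum_mul_left]
    rw [mul_mul_of_mem_imagUnits hI, add_neg_cancel, smul_zero]

/-! ### The polyanalytic Fueter map on power series -/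

lemma isOpen_originBall (Ω : Set ℍ[ℝ]) : IsOpen (originBall Ω) := by
  refine isOpen_iff_mem_nhds.2 ?_
  rintro q ⟨r, hq, hr⟩
  exact Filter.mem_of_superset (Metric.isOpen_ball.mem_nhds hq) fun p hp => ⟨r, hp, hr⟩

lemma originBall_subset (Ω : Set ℍ[ℝ]) : originBall Ω ⊆ Ω := fun _ ⟨_, hq, hr⟩ => hr hq

lemma originBall_originBall (Ω : Set ℍ[ℝ]) : originBall (originBall Ω) = originBall Ω :=
  (originBall_subset _).antisymm fun _ ⟨r, hq, hr⟩ => ⟨r, hq, fun _ hp => ⟨r, hp, hr⟩⟩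

lemma isAxiallySymmetric_originBall (Ω : Set ℍ[ℝ]) : IsAxiallySymmetric (originBall Ω) :=
  fun x y I hI J hJ ⟨r, hq, hr⟩ => ⟨r, IsAxiallySymmetric.ball r x y I hI J hJ hq, hr⟩

/-- Slice regular functions have a power series expansion on the origin ball. -/
lemma IsSliceRegular.exists_qSeries {Ω : Set ℍ[ℝ]} (hΩ : IsOpen Ω) (hsym : IsAxiallySymmetric Ω)
    {F : ℍ[ℝ] → ℍ[ℝ]} (hF : IsSliceRegular Ω F) :
    ∃ c : ℕ → ℍ[ℝ], (∀ q ∈ originBall Ω, Summable fun j => ‖c j‖ * ‖q‖ ^ j) ∧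
      Set.EqOn F (qSeries c) (originBall Ω) := by
  have hd : ∀ r : ℝ, Metric.ball 0 r ⊆ Ω →
      DifferentiableOn ℂ (F ∘ sliceHom unitI unitI_mem) (Metric.ball 0 r) := fun r hr =>
    (hF.differentiableOn hΩ hsym).mono fun z hz => (hsym.sliceHom_mem_iff unitI_mem z).1 (hr (by
      rwa [mem_ball_zero_iff, norm_sliceHom, ← mem_ball_zero_iff]))
  refine ⟨taylorCoeff (F ∘ sliceHom unitI unitI_mem), ?_, ?_⟩
  · rintro q ⟨r, hq, hr⟩
    exact summable_norm_taylorCoeff (hd r hr) (norm_nonneg q) (mem_ball_zero_iff.1 hq)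
  · rintro q ⟨r, hq, hr⟩
    rw [sliceExt_eqOn_qSeries (hd r hr) hq]
    exact hF.slice.eqOn_sliceExt hsym (fun _ _ => rfl) (hr hq)

/-- The Fueter map is computed from any decomposition, on any open subset where its components are
power series. -/
lemma IsPolyDecomposition.hasAppellExpansion {n : ℕ} {Ω U : Set ℍ[ℝ]} (hΩ : IsOpen Ω)
    (hsym : IsAxiallySymmetric Ω) (hU : IsOpen U) (hUΩ : U ⊆ Ω) {g : ℍ[ℝ] → ℍ[ℝ]}
    {F : Fin (n + 1) → ℍ[ℝ] → ℍ[ℝ]} (hF : IsPolyDecomposition n Ω g F)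
    {α : Fin (n + 1) → ℕ → ℍ[ℝ]}
    (hα : ∀ k, ∀ q ∈ U, Summable fun j => ‖α k j‖ * ‖q‖ ^ j)
    (hFα : ∀ k, Set.EqOn (F k) (qSeries (α k)) U) :
    HasAppellExpansion n (fueterMap n Ω g) (fueterCoeff α) U := by
  have hex : ∃ F, IsPolyDecomposition n Ω g F := ⟨F, hF⟩
  have hcomp : IsPolyDecomposition n Ω g (polyComponent n Ω g) := by
    rw [polyComponent, dif_pos hex]
    exact hex.choose_spec
  intro q hq
  obtain ⟨p, hpU, hqp, -, -⟩ := exists_mem_norm_lt hU hq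
  have hsum : ∀ k : Fin (n + 1), HasSum (fun s : ℕ => appellM k s q * fueterCoeff α k s)
      (q.re ^ (k : ℕ) • Laplacian.laplacian (polyComponent n Ω g k) q) := fun k => by
    have he : polyComponent n Ω g k =ᶠ[nhds q] qSeries (α k) :=
      (((hcomp.unique hΩ hsym hF k).mono hUΩ).trans (hFα k)).eventuallyEq_of_mem
        (hU.mem_nhds hq)
    rw [(InnerProductSpace.laplacian_congr_nhds he).eq_of_nhds]
    have := (laplacian_qSeries (hα k p hpU) hqp).const_smul (q.re ^ (k : ℕ))
    simpa only [appellM, fueterCoeff, smul_mul_assoc] using this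
  exact ⟨fun k => (hsum k).summable, by simp only [fueterMap, (hsum _).tsum_eq]⟩

lemma isPolyDecomposition_qSeries {n : ℕ} {U : Set ℍ[ℝ]} (hU : IsOpen U) {g : ℍ[ℝ] → ℍ[ℝ]}
    {α : Fin (n + 1) → ℕ → ℍ[ℝ]} (hα : ∀ k, ∀ q ∈ U, Summable fun j => ‖α k j‖ * ‖q‖ ^ j)
    (hg : HasPolyExpansion n g α U) :
    IsPolyDecomposition n U g fun k => qSeries (α k) :=
  ⟨fun k => isSliceRegular_qSeries hU (hα k), fun q hq => by
    simpa only [tsum_conj_pow] using (hg q hq).2⟩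

theorem IsSlicePolyanalytic.exists_hasPolyExpansion {n : ℕ} {Ω : Set ℍ[ℝ]} (hΩ : IsOpen Ω)
    (hsym : IsAxiallySymmetric Ω) {g : ℍ[ℝ] → ℍ[ℝ]} (hg : IsSlicePolyanalytic (n + 1) Ω g) :
    ∃ α, HasPolyExpansion n g α (originBall Ω) := by
  obtain ⟨F, hF⟩ := hg.exists_polyDecomposition hΩ hsym
  choose α hα hFα using fun k => (hF.1 k).exists_qSeries hΩ hsym
  refine ⟨α, fun q hq => ⟨fun k => summable_conj_pow (hα k q hq), ?_⟩⟩
  simp only [tsum_conj_pow, hF.2 q (originBall_subset Ω hq)]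
  exact Finset.sum_congr rfl fun k _ => by rw [hFα k hq]

/-- The coefficients are those of any expansion of `g`: its series converge on the origin ball and
form a decomposition there, which is unique. -/
theorem IsSlicePolyanalytic.hasAppellExpansion {n : ℕ} {Ω : Set ℍ[ℝ]} (hΩ : IsOpen Ω)
    (hsym : IsAxiallySymmetric Ω) {g : ℍ[ℝ] → ℍ[ℝ]} (hg : IsSlicePolyanalytic (n + 1) Ω g)
    {α : Fin (n + 1) → ℕ → ℍ[ℝ]} (hα : HasPolyExpansion n g α (originBall Ω)) :
    HasAppellExpansion n (fueterMap n Ω g) (fueterCoeff α) (originBall Ω) := by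
  obtain ⟨F, hF⟩ := hg.exists_polyDecomposition hΩ hsym
  have hB := isOpen_originBall Ω
  have hs : ∀ k, ∀ q ∈ originBall Ω, Summable fun j => ‖α k j‖ * ‖q‖ ^ j := fun k =>
    summable_of_summable_conj_pow hB fun q hq => (hα q hq).1 k
  exact hF.hasAppellExpansion hΩ hsym hB (originBall_subset Ω) hs fun k =>
    (hF.mono (originBall_subset Ω)).unique hB (isAxiallySymmetric_originBall Ω)
      (isPolyDecomposition_qSeries hB hs hα) k

/-- A function with an Appell expansion is the Fueter image of the polyanalytic function with the
corresponding coefficients. -/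
theorem HasAppellExpansion.exists_preimage {n : ℕ} {Ω : Set ℍ[ℝ]} (hΩ : IsOpen Ω)
    (hsym : IsAxiallySymmetric Ω) {f : ℍ[ℝ] → ℍ[ℝ]} {α : Fin (n + 1) → ℕ → ℍ[ℝ]}
    (hf : HasAppellExpansion n f (fueterCoeff α) Ω) :
    ∃ g, IsSlicePolyanalytic (n + 1) Ω g ∧ HasPolyExpansion n g α Ω ∧
      Set.EqOn f (fueterMap n Ω g) Ω := by
  have hα : ∀ k, ∀ q ∈ Ω, Summable fun j => ‖α k j‖ * ‖q‖ ^ j := fun k =>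
    summable_of_summable_appellM hΩ fun q hq => (hf q hq).1 k
  have hg : HasPolyExpansion n
      (fun q => ∑ k : Fin (n + 1), ∑' j : ℕ, star q ^ (k : ℕ) * q ^ j * α k j) α Ω :=
    fun q hq => ⟨fun k => summable_conj_pow (hα k q hq), rfl⟩
  have hF := isPolyDecomposition_qSeries hΩ hα hg
  refine ⟨_, hF.isSlicePolyanalytic hΩ hsym, hg, fun q hq => ?_⟩
  rw [(hf q hq).2, (hF.hasAppellExpansion hΩ hsym hΩ subset_rfl hα (fun _ _ _ => rfl) q hq).2]

/-- Every coefficient family arises from the coefficients of a polyanalytic function; the terms of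
degree `0` and `1`, which are killed by the Laplacian, may be taken to be `0`. -/
lemma exists_fueterCoeff_eq {n : ℕ} (β : Fin (n + 1) → ℕ → ℍ[ℝ]) : ∃ α, fueterCoeff α = β := by
  refine ⟨fun k j => (-2 * ((j - 2 : ℕ) + 1 : ℝ) * ((j - 2 : ℕ) + 2))⁻¹ • β k (j - 2), ?_⟩
  ext1 k
  ext1 s
  have h : -2 * ((s : ℝ) + 1) * (s + 2) ≠ 0 :=
    mul_ne_zero (mul_ne_zero (by norm_num) (by positivity)) (by positivity)
  simp only [fueterCoeff, Nat.add_sub_cancel]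
  rw [smul_smul, mul_inv_cancel₀ h, one_smul]

theorem InFueterRange.exists_hasAppellExpansion {n : ℕ} {Ω : Set ℍ[ℝ]} (hΩ : IsOpen Ω)
    (hsym : IsAxiallySymmetric Ω) {f : ℍ[ℝ] → ℍ[ℝ]} (hf : InFueterRange n Ω f) :
    ∃ β, HasAppellExpansion n f β (originBall Ω) := by
  obtain ⟨g, hg, hfg⟩ := hf
  obtain ⟨α, hα⟩ := hg.exists_hasPolyExpansion hΩ hsym
  refine ⟨fueterCoeff α, fun q hq => ?_⟩
  rw [hfg (originBall_subset Ω hq)]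
  exact hg.hasAppellExpansion hΩ hsym hα q hq

theorem HasAppellExpansion.inFueterRange {n : ℕ} {Ω : Set ℍ[ℝ]} (hΩ : IsOpen Ω)
    (hsym : IsAxiallySymmetric Ω) {f : ℍ[ℝ] → ℍ[ℝ]} {β : Fin (n + 1) → ℕ → ℍ[ℝ]}
    (hf : HasAppellExpansion n f β Ω) : InFueterRange n Ω f := by
  obtain ⟨α, rfl⟩ := exists_fueterCoeff_eq β
  obtain ⟨g, hg, -, hfg⟩ := hf.exists_preimage hΩ hsym
  exact ⟨g, hg, hfg⟩

end SlicePoly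

theorem mainTheorem3 (n : ℕ) (Ω : Set (Quaternion ℝ))
    (hsym : SlicePoly.IsAxiallySymmetric Ω) (hdom : SlicePoly.IsSliceDomain Ω)
    (h0 : (0 : Quaternion ℝ) ∈ Ω) :
    -- the characterization of the range on the ball of convergence
    (∀ f : Quaternion ℝ → Quaternion ℝ,
      SlicePoly.InFueterRange n (SlicePoly.originBall Ω) f ↔
        ∃ β, SlicePoly.HasAppellExpansion n f β (SlicePoly.originBall Ω)) ∧
    -- the two directions for the range on `Ω` itself
    (∀ f : Quaternion ℝ → Quaternion ℝ, SlicePoly.InFueterRange n Ω f →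
      ∃ β, SlicePoly.HasAppellExpansion n f β (SlicePoly.originBall Ω)) ∧
    (∀ f : Quaternion ℝ → Quaternion ℝ,
      (∃ β, SlicePoly.HasAppellExpansion n f β Ω) → SlicePoly.InFueterRange n Ω f) ∧
    -- the coefficients of the image of a slice polyanalytic function
    (∀ g : Quaternion ℝ → Quaternion ℝ, SlicePoly.IsSlicePolyanalytic (n + 1) Ω g →
      (∃ α, SlicePoly.HasPolyExpansion n g α (SlicePoly.originBall Ω)) ∧
      ∀ α, SlicePoly.HasPolyExpansion n g α (SlicePoly.originBall Ω) →
        SlicePoly.HasAppellExpansion n (SlicePoly.fueterMap n Ω g) (SlicePoly.fueterCoeff α)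
          (SlicePoly.originBall Ω)) ∧
    -- the coefficients of a preimage
    (∀ (f : Quaternion ℝ → Quaternion ℝ) (α : Fin (n + 1) → ℕ → Quaternion ℝ),
      SlicePoly.HasAppellExpansion n f (SlicePoly.fueterCoeff α) Ω →
        ∃ g, SlicePoly.IsSlicePolyanalytic (n + 1) Ω g ∧ SlicePoly.HasPolyExpansion n g α Ω ∧
          Set.EqOn f (SlicePoly.fueterMap n Ω g) Ω) := by
  have hΩ := hdom.isOpen
  have hB := SlicePoly.isOpen_originBall Ω
  have hBsym := SlicePoly.isAxiallySymmetric_originBall Ω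
  refine ⟨fun f => ⟨fun hf => ?_, fun ⟨_, hf⟩ => hf.inFueterRange hB hBsym⟩,
    fun f hf => hf.exists_hasAppellExpansion hΩ hsym,
    fun f ⟨_, hf⟩ => hf.inFueterRange hΩ hsym,
    fun g hg => ⟨hg.exists_hasPolyExpansion hΩ hsym, fun _ hα => hg.hasAppellExpansion hΩ hsym hα⟩,
    fun f α hf => hf.exists_preimage hΩ hsym⟩
  have := hf.exists_hasAppellExpansion hB hBsym
  rwa [SlicePoly.originBall_originBall] at this
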